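/- Let $n\ge 1$, $0<\alpha<n$, $0\le\lambda\le n$ and $\beta\in(0,1)$. A Young function is a convex, left-continuous function $\Phi:[0,\infty)\to[0,\infty]$ with $\lim_{r\to0+}\Phi(r)=\Phi(0)=0$ and $\lim_{r\to\infty}\Phi(r)=\infty$; put $\Phi^{-1}(s)=\inf\{r\ge0:\Phi(r)>s\}$ for $0\le s\le\infty$. Let $\Phi$ be a Young function satisfying the $\Delta'$-condition: for some $C>1$, $\Phi(tr)\le C\,\Phi(t)\Phi(r)$ for all $t,r\ge0$ (with $0\cdot\infty=0$). Let $\Psi(t)=\Phi(t^{1/\beta})$. For balls $B(x,r)\subset\mathbb R^n$ with Lebesgue measure $|B(x,r)|$ let $$M_\alpha f(x)=\sup_{t>0}|B(x,t)|^{-1+\frac{\alpha}{n}}\int_{B(x,t)}|f(y)|\,dy .$$ Let $$\|f\|_{L^\Phi}=\inf\Big\{l>0:\int_{\mathbb R^n}\Phi\big(|f(x)|/l\big)\,dx\le1\Big\},\qquad \|f\|_{WL^\Phi}=\inf\Big\{l>0:\sup_{t>0}\Phi(t/l)\,|\{x:|f(x)|>t\}|\le1\Big\}.$$ The space $L^\Phi(\mathbb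 R^n)$ consists of the $f\in L^1_{\rm loc}(\mathbb R^n)$ with $\int\Phi(k|f|)\,dx<\infty$ for some $k>0$, and $WL^\Phi(\mathbb R^n)$ of the $f\in L^1_{\rm loc}(\mathbb R^n)$ with $\|f\|_{WL^\Phi}<\infty$; $L^\Phi_{\rm loc}$ and $WL^\Phi_{\rm loc}$ consist of the $f$ such that $f\chi_B$ lies in $L^\Phi$, respectively $WL^\Phi$, for every ball $B$. The Orlicz--Morrey space $\mathcal M^{\Phi,\lambda}(\mathbb R^n)$ is the set of $f\in L^\Phi_{\rm loc}$ with $$\|f\|_{\mathcal M^{\Phi,\lambda}}=\sup_{x\in\mathbb R^n,\,r>0}\Phi^{-1}\big(|B(x,r)|^{-\lambda/n}\big)\,\|f\chi_{B(x,r)}\|_{L^\Phi}<\infty,$$ and the weak Orlicz--Morrey space $W\mathcal M^{\Phi,\lambda}(\mathbb R^n)$ is the set of $f\in WL^\Phi_{\rm loc}$ for which the same expression with $\|\cdot\|_{WL^\Phi}$ in place of $\|\cdot\|_{L^\Phi}$, denoted $\|f\|_{W\mathcal M^{\Phi,\lambda}}$, is finite. Assume that there is $C>0$ such that for all $t>0$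 $$\sup_{t<r<\infty} r^{\alpha}\,\frac{\Phi^{-1}(r^{-n})}{\Phi^{-1}(r^{-\lambda})}\le C\,t^{\alpha}\,\frac{\Phi^{-1}(t^{-n})}{\Phi^{-1}(t^{-\lambda})}.$$ Then the condition that there is $C>0$ such that for all $t>0$ $$t^{\alpha}\le C\left[\frac{\Phi^{-1}(t^{-n})}{\Phi^{-1}(t^{-\lambda})}\right]^{\beta-1}$$ is necessary and sufficient for $M_\alpha$ to be bounded from $\mathcal M^{\Phi,\lambda}(\mathbb R^n)$ to $W\mathcal M^{\Psi,\lambda}(\mathbb R^n)$, that is, for the existence of a constant $C$ such that $M_\alpha f\in W\mathcal M^{\Psi,\lambda}(\mathbb R^n)$ and $\|M_\alpha f\|_{W\mathcal M^{\Psi,\lambda}}\le C\,\|f\|_{\mathcal M^{\Phi,\lambda}}$ for all $f\in\mathcal M^{\Phi,\lambda}(\mathbb R^n)$. -/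

import Mathlib

open MeasureTheory Set Filter Topology
open scoped NNReal ENNReal

namespace OrliczMorrey

/-- The Euclidean space `ℝⁿ`. -/
abbrev Rn (n : ℕ) : Type := EuclideanSpace ℝ (Fin n)

/-- Young functions `Φ : [0,∞) → [0,∞]`. -/
structure IsYoung (Φ : ℝ≥0 → ℝ≥0∞) : Prop where
  convex : ConvexOn ℝ≥0 univ Φ
  left_continuous : ∀ r, ContinuousWithinAt Φ (Iic r) r
  map_zero : Φ 0 = 0
  tendsto_zero : Tendsto Φ (𝓝[>] 0) (𝓝 0)
  tendsto_top : Tendsto Φ atTop (𝓝 ∞)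

/-- The `Δ'`-condition for a Young function: `Φ(tr) ≤ C Φ(t) Φ(r)` for some `C > 1`
(with the usual convention `0 · ∞ = 0`). -/
def DeltaPrime (Φ : ℝ≥0 → ℝ≥0∞) : Prop :=
  IsYoung Φ ∧ ∃ C : ℝ≥0, 1 < C ∧ ∀ t r : ℝ≥0, Φ (t * r) ≤ C * Φ t * Φ r

/-- The generalized inverse `Φ⁻¹(s) = inf {r ≥ 0 : Φ(r) > s}`, `0 ≤ s ≤ ∞`, with `inf ∅ = ∞`. -/
noncomputable def youngInv (Φ : ℝ≥0 → ℝ≥0∞) (s : ℝ≥0∞) : ℝ≥0∞ :=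
  ⨅ (r : ℝ≥0) (_ : s < Φ r), (r : ℝ≥0∞)

section Strong

variable {n : ℕ} {F : Type*} [NormedAddCommGroup F]

/-- The Luxemburg norm `‖f‖_{L^Φ} = inf {l > 0 : ∫ Φ(|f(x)| / l) dx ≤ 1}`. -/
noncomputable def orliczNorm (Φ : ℝ≥0 → ℝ≥0∞) (f : Rn n → F) : ℝ≥0∞ :=
  ⨅ (l : ℝ≥0) (_ : 0 < l) (_ : (∫⁻ x, Φ (‖f x‖₊ / l)) ≤ 1), (l : ℝ≥0∞)

/-- Membership in the Orlicz space `L^Φ(ℝⁿ)`. -/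
def MemOrlicz (Φ : ℝ≥0 → ℝ≥0∞) (f : Rn n → F) : Prop :=
  LocallyIntegrable f volume ∧ ∃ k : ℝ≥0, 0 < k ∧ (∫⁻ x, Φ (k * ‖f x‖₊)) < ∞

/-- Membership in `L^Φ_loc(ℝⁿ)`: `f χ_B ∈ L^Φ(ℝⁿ)` for all balls `B`. -/
def MemOrliczLoc (Φ : ℝ≥0 → ℝ≥0∞) (f : Rn n → F) : Prop :=
  ∀ (x : Rn n) (r : ℝ), 0 < r → MemOrlicz Φ ((Metric.ball x r).indicator f)

/-- The Orlicz-Morrey quasinorm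
`sup_{x, r > 0} Φ⁻¹(|B(x,r)|^{-lam/n}) ‖f χ_{B(x,r)}‖_{L^Φ}`. -/
noncomputable def orliczMorreyNorm (Φ : ℝ≥0 → ℝ≥0∞) (lam : ℝ) (f : Rn n → F) : ℝ≥0∞ :=
  ⨆ (x : Rn n) (r : ℝ) (_ : 0 < r),
    youngInv Φ (volume (Metric.ball x r) ^ (-lam / n)) *
      orliczNorm Φ ((Metric.ball x r).indicator f)

/-- Membership in the Orlicz-Morrey space `M^{Φ,lam}(ℝⁿ)`. -/
def MemOrliczMorrey (Φ : ℝ≥0 → ℝ≥0∞) (lam : ℝ) (f : Rn n → F) : Prop :=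
  MemOrliczLoc Φ f ∧ orliczMorreyNorm Φ lam f < ∞

/-- The fractional maximal function
`M_α f(x) = sup_{t > 0} |B(x,t)|^{-1 + α/n} ∫_{B(x,t)} |f(y)| dy`, with values in `[0,∞]`. -/
noncomputable def fracMaximal (α : ℝ) (f : Rn n → F) (x : Rn n) : ℝ≥0∞ :=
  ⨆ (t : ℝ) (_ : 0 < t),
    volume (Metric.ball x t) ^ (-1 + α / n) * ∫⁻ y in Metric.ball x t, ‖f y‖ₑ

end Strong

section Weak

/-! The weak spaces are set up for functions with values in `[0,∞]`, the case needed for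
maximal functions. -/

variable {n : ℕ}

/-- The distribution function `d_g(t) = |{x : g(x) > t}|` of `g : ℝⁿ → [0,∞]`. -/
noncomputable def distrib (g : Rn n → ℝ≥0∞) (t : ℝ≥0) : ℝ≥0∞ :=
  volume {x | (t : ℝ≥0∞) < g x}

/-- The weak Orlicz quasinorm `inf {l > 0 : sup_{t > 0} Φ(t / l) d_g(t) ≤ 1}`. -/
noncomputable def weakOrliczNorm (Φ : ℝ≥0 → ℝ≥0∞) (g : Rn n → ℝ≥0∞) : ℝ≥0∞ :=
  ⨅ (l : ℝ≥0) (_ : 0 < l) (_ : (⨆ (t : ℝ≥0) (_ : 0 < t), Φ (t / l) * distrib g t) ≤ 1),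
    (l : ℝ≥0∞)

/-- Membership in the weak Orlicz space `WL^Φ(ℝⁿ)`. -/
def MemWeakOrlicz (Φ : ℝ≥0 → ℝ≥0∞) (g : Rn n → ℝ≥0∞) : Prop :=
  LocallyIntegrable g volume ∧ weakOrliczNorm Φ g < ∞

/-- Membership in `WL^Φ_loc(ℝⁿ)`: `g χ_B ∈ WL^Φ(ℝⁿ)` for all balls `B`. -/
def MemWeakOrliczLoc (Φ : ℝ≥0 → ℝ≥0∞) (g : Rn n → ℝ≥0∞) : Prop :=
  ∀ (x : Rn n) (r : ℝ), 0 < r → MemWeakOrlicz Φ ((Metric.ball x r).indicator g)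

/-- The weak Orlicz-Morrey quasinorm
`sup_{x, r > 0} Φ⁻¹(|B(x,r)|^{-lam/n}) ‖g χ_{B(x,r)}‖_{WL^Φ}`. -/
noncomputable def weakOrliczMorreyNorm (Φ : ℝ≥0 → ℝ≥0∞) (lam : ℝ) (g : Rn n → ℝ≥0∞) :
    ℝ≥0∞ :=
  ⨆ (x : Rn n) (r : ℝ) (_ : 0 < r),
    youngInv Φ (volume (Metric.ball x r) ^ (-lam / n)) *
      weakOrliczNorm Φ ((Metric.ball x r).indicator g)

/-- Membership in the weak Orlicz-Morrey space `WM^{Φ,lam}(ℝⁿ)`. -/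
def MemWeakOrliczMorrey (Φ : ℝ≥0 → ℝ≥0∞) (lam : ℝ) (g : Rn n → ℝ≥0∞) : Prop :=
  MemWeakOrliczLoc Φ g ∧ weakOrliczMorreyNorm Φ lam g < ∞

end Weak

/-- `M_α` is bounded from `M^{Φ,lam}(ℝⁿ)` (of `𝕜`-valued functions) to `WM^{Ψ,lam}(ℝⁿ)`. -/
def FracMaximalBounded (𝕜 : Type*) [RCLike 𝕜] (n : ℕ) (α lam : ℝ) (Φ Ψ : ℝ≥0 → ℝ≥0∞) :
    Prop :=
  ∃ C : ℝ≥0, ∀ f : Rn n → 𝕜, MemOrliczMorrey Φ lam f →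
    MemWeakOrliczMorrey Ψ lam (fracMaximal α f) ∧
      weakOrliczMorreyNorm Ψ lam (fracMaximal α f) ≤ C * orliczMorreyNorm Φ lam f

/-- The quotient `Φ⁻¹(t^{-n}) / Φ⁻¹(t^{-lam})`, for `t > 0`. -/
noncomputable def invQuotient (n : ℕ) (lam : ℝ) (Φ : ℝ≥0 → ℝ≥0∞) (t : ℝ≥0) : ℝ≥0∞ :=
  youngInv Φ ((t : ℝ≥0∞) ^ (-(n : ℝ))) / youngInv Φ ((t : ℝ≥0∞) ^ (-lam))

end OrliczMorrey

/-! Write `a(r) = Φ⁻¹(r^{-n})`, `w(r) = Φ⁻¹(r^{-lam})` and `q = a / w`. Convexity makes `Φ⁻¹(cs) ≤ c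
Φ⁻¹(s)` for `c ≥ 1`, so ball volumes may be replaced by powers of the radius at the cost of
constants. Since `r^α` increases, the regularity hypothesis makes `q` almost decreasing, and this is
the form in which it is used.

Sufficiency rests on a Hedberg-type pointwise bound. If `f` has Morrey norm at most `N`, a
Jensen-type inequality bounds its average `A` over a ball of radius `ρ` by a multiple of `N q(ρ)`.
The assumption `ρ^α ≲ q(ρ)^{β-1}` then gives `ρ^α A ≲ (A / q(ρ))^{1-β} A^β ≲ N^{1-β} A^β`, that is,
`M_α f ≲ N^{1-β} (M f)^β` with `M` the centred Hardy–Littlewood maximal function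
(`IsYoung.exists_average_of_lt_fracMaximal`). As `Ψ(t) = Φ(t^{1/β})`, a weak estimate for `M` at the
level of `Φ` suffices. That estimate (`IsYoung.exists_weak_type`) comes from a Vitali covering on
`B(x, 2r)`; large radii are harmless because `q` is almost decreasing.

Necessity is tested on `f = χ_{B(0,t)}`: its Morrey norm is `≲ 1 / q(t)`, while `M_α f ≳ t^α` on
that ball forces the target norm to be `≳ t^α q(t)^{-β}`. Comparing the two gives `t^α ≲
q(t)^{β-1}`. -/

namespace OrliczMorrey

/-! ### Young functions and their generalized inverses -/

section Young

variable {Φ Ψ : ℝ≥0 → ℝ≥0∞}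

theorem IsYoung.map_mul_le (h : IsYoung Φ) {c : ℝ≥0} (hc : c ≤ 1) (u : ℝ≥0) :
    Φ (c * u) ≤ c * Φ u := by
  have := h.convex.2 (mem_univ u) (mem_univ 0) (zero_le (a := c)) (zero_le (a := 1 - c))
    (add_tsub_cancel_of_le hc)
  simpa [h.map_zero, ENNReal.smul_def] using this

theorem IsYoung.mono (h : IsYoung Φ) : Monotone Φ := by
  intro s t hst
  rcases eq_or_ne t 0 with rfl | ht
  · rw [le_antisymm hst (zero_le)]
  · have h1 : s / t ≤ 1 := div_le_one_of_le₀ hst (zero_le)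
    calc Φ s = Φ (s / t * t) := by rw [div_mul_cancel₀ _ ht]
      _ ≤ (s / t : ℝ≥0) * Φ t := h.map_mul_le h1 t
      _ ≤ 1 * Φ t := by gcongr; exact_mod_cast h1
      _ = Φ t := one_mul _

theorem IsYoung.mul_le (h : IsYoung Φ) {c : ℝ≥0} (hc : 1 ≤ c) (u : ℝ≥0) :
    c * Φ u ≤ Φ (c * u) := by
  have hc0 : c ≠ 0 := (zero_lt_one.trans_le hc).ne'
  have h1 := h.map_mul_le (inv_le_one_of_one_le₀ hc) (c * u)
  rw [inv_mul_cancel_left₀ hc0] at h1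
  calc (c : ℝ≥0∞) * Φ u ≤ c * ((c⁻¹ : ℝ≥0) * Φ (c * u)) := by gcongr
    _ = Φ (c * u) := by
      rw [← mul_assoc, ← ENNReal.coe_mul, mul_inv_cancel₀ hc0, ENNReal.coe_one, one_mul]

/-- The function `u ↦ Φ u / u` is nondecreasing. -/
theorem IsYoung.mul_map_le (h : IsYoung Φ) {s u : ℝ≥0} (hsu : s ≤ u) :
    (u : ℝ≥0∞) * Φ s ≤ s * Φ u := by
  rcases eq_or_ne u 0 with rfl | hu
  · simp
  have h1 : s / u ≤ 1 := div_le_one_of_le₀ hsu (zero_le)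
  calc (u : ℝ≥0∞) * Φ s = u * Φ (s / u * u) := by rw [div_mul_cancel₀ _ hu]
    _ ≤ u * ((s / u : ℝ≥0) * Φ u) := by gcongr; exact h.map_mul_le h1 u
    _ = s * Φ u := by rw [← mul_assoc, ← ENNReal.coe_mul, mul_div_cancel₀ _ hu]

theorem IsYoung.exists_lt (h : IsYoung Φ) {s : ℝ≥0∞} (hs : s ≠ ∞) : ∃ u, s < Φ u :=
  (h.tendsto_top.eventually (lt_mem_nhds hs.lt_top)).exists

theorem IsYoung.exists_pos_lt (h : IsYoung Φ) {s : ℝ≥0∞} (hs : s ≠ 0) : ∃ u, 0 < u ∧ Φ u < s := by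
  obtain ⟨u, hu, hu'⟩ := ((h.tendsto_zero.eventually (gt_mem_nhds (pos_iff_ne_zero.2 hs))).and
    self_mem_nhdsWithin).exists
  exact ⟨u, hu', hu⟩

theorem youngInv_le_of_lt {s : ℝ≥0∞} {u : ℝ≥0} (hu : s < Φ u) : youngInv Φ s ≤ u :=
  iInf₂_le u hu

theorem le_of_lt_youngInv {s : ℝ≥0∞} {u : ℝ≥0} (hu : (u : ℝ≥0∞) < youngInv Φ s) : Φ u ≤ s := by
  by_contra! hs
  exact hu.not_ge (iInf₂_le u hs)

theorem IsYoung.le_youngInv (h : IsYoung Φ) {s : ℝ≥0∞} {u : ℝ≥0} (hu : Φ u ≤ s) :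
    (u : ℝ≥0∞) ≤ youngInv Φ s := by
  refine le_iInf₂ fun r hr => ?_
  by_contra! hlt
  exact (hr.trans_le (h.mono (by exact_mod_cast hlt.le))).not_ge hu

theorem youngInv_mono : Monotone (youngInv Φ) := fun _ _ hst =>
  le_iInf₂ fun r hr => iInf₂_le r (hst.trans_lt hr)

/-- The dual of `c Φ(u) ≤ Φ(cu)`. It is the source of every comparison of `Φ⁻¹` at proportional
arguments, hence of the doubling of `invProfile` and of the insensitivity to the volume of the unit
ball. -/
theorem IsYoung.youngInv_mul_le (h : IsYoung Φ) {c : ℝ≥0} (hc : 1 ≤ c) (s : ℝ≥0∞) :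
    youngInv Φ (c * s) ≤ c * youngInv Φ s := by
  have hc0 : c ≠ 0 := (zero_lt_one.trans_le hc).ne'
  rw [mul_comm _ (youngInv Φ s), ← ENNReal.div_le_iff (by simpa using hc0) (by simp)]
  refine le_iInf₂ fun r hr => ?_
  rw [ENNReal.div_le_iff (by simpa using hc0) (by simp), mul_comm (r : ℝ≥0∞), ← ENNReal.coe_mul]
  have hcr : c * s < Φ (c * r) :=
    ((ENNReal.mul_lt_mul_iff_right (by simpa using hc0) (by simp)).2 hr).trans_le (h.mul_le hc r)
  exact youngInv_le_of_lt hcr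

theorem IsYoung.youngInv_ne_top (h : IsYoung Φ) {s : ℝ≥0∞} (hs : s ≠ ∞) : youngInv Φ s ≠ ∞ := by
  obtain ⟨u, hu⟩ := h.exists_lt hs
  exact ((iInf₂_le u hu).trans_lt ENNReal.coe_lt_top).ne

theorem IsYoung.youngInv_ne_zero (h : IsYoung Φ) {s : ℝ≥0∞} (hs : s ≠ 0) : youngInv Φ s ≠ 0 := by
  obtain ⟨u, hu, hu'⟩ := h.exists_pos_lt hs
  exact ((ENNReal.coe_pos.2 hu).trans_le (h.le_youngInv hu'.le)).ne'

/-- The power `β` is an order isomorphism of `[0,∞]`, so it passes through the infimum, and `r ↦ r ^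
β` matches the two index sets. -/
theorem youngInv_rpow {β : ℝ} (hβ : 0 < β) (hΨ : ∀ t : ℝ≥0, Ψ t = Φ (t ^ (1 / β))) (s : ℝ≥0∞) :
    youngInv Ψ s = youngInv Φ s ^ β := by
  have h1 : youngInv Φ s ^ β = ⨅ (r : ℝ≥0) (_ : s < Φ r), (r : ℝ≥0∞) ^ β := by
    exact (ENNReal.orderIsoRpow β hβ).map_iInf₂ fun (r : ℝ≥0) (_ : s < Φ r) => (r : ℝ≥0∞)
  rw [h1]
  apply le_antisymm
  · refine le_iInf₂ fun r hr => ?_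
    rw [← ENNReal.coe_rpow_of_nonneg _ hβ.le]
    refine iInf₂_le _ ?_
    rw [hΨ, ← NNReal.rpow_mul, mul_one_div_cancel hβ.ne', NNReal.rpow_one]
    exact hr
  · refine le_iInf₂ fun r hr => ?_
    rw [hΨ] at hr
    refine (iInf₂_le (f := fun (r : ℝ≥0) (_ : s < Φ r) => (r : ℝ≥0∞) ^ β) _ hr).trans_eq ?_
    rw [← ENNReal.coe_rpow_of_nonneg _ hβ.le, ← NNReal.rpow_mul, one_div_mul_cancel hβ.ne',
      NNReal.rpow_one]

/-- The finite value `Φ⁻¹(r^{-s})`, `r > 0`. -/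
noncomputable def invProfile (Φ : ℝ≥0 → ℝ≥0∞) (s : ℝ) (r : ℝ≥0) : ℝ≥0 :=
  (youngInv Φ ((r : ℝ≥0∞) ^ (-s))).toNNReal

theorem IsYoung.coe_invProfile (h : IsYoung Φ) (s : ℝ) {r : ℝ≥0} (hr : 0 < r) :
    (invProfile Φ s r : ℝ≥0∞) = youngInv Φ ((r : ℝ≥0∞) ^ (-s)) :=
  ENNReal.coe_toNNReal (h.youngInv_ne_top (by simp [← ENNReal.coe_rpow_of_ne_zero hr.ne']))

theorem IsYoung.invProfile_pos (h : IsYoung Φ) (s : ℝ) {r : ℝ≥0} (hr : 0 < r) :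
    0 < invProfile Φ s r := by
  rw [← ENNReal.coe_pos, h.coe_invProfile s hr, pos_iff_ne_zero]
  apply h.youngInv_ne_zero
  simp [← ENNReal.coe_rpow_of_ne_zero hr.ne', hr.ne']

theorem IsYoung.invProfile_anti (h : IsYoung Φ) {s : ℝ} (hs : 0 ≤ s) {r t : ℝ≥0} (hr : 0 < r)
    (hrt : r ≤ t) : invProfile Φ s t ≤ invProfile Φ s r := by
  rw [← ENNReal.coe_le_coe, h.coe_invProfile s hr, h.coe_invProfile s (hr.trans_le hrt)]
  apply youngInv_mono
  rw [ENNReal.rpow_neg, ENNReal.rpow_neg, ENNReal.inv_le_inv]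
  gcongr

theorem IsYoung.invProfile_le_two_mul (h : IsYoung Φ) {s : ℝ} (hs : 0 ≤ s) {r : ℝ≥0}
    (hr : 0 < r) : invProfile Φ s r ≤ 2 ^ s * invProfile Φ s (2 * r) := by
  rw [← ENNReal.coe_le_coe, ENNReal.coe_mul, h.coe_invProfile s hr,
    h.coe_invProfile s (mul_pos two_pos hr)]
  refine le_trans (le_of_eq ?_) (h.youngInv_mul_le (NNReal.one_le_rpow one_le_two hs) _)
  rw [← ENNReal.coe_rpow_of_ne_zero hr.ne', ← ENNReal.coe_rpow_of_ne_zero (mul_pos two_pos hr).ne',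
    ← ENNReal.coe_mul, NNReal.mul_rpow, ← mul_assoc, ← NNReal.rpow_add two_ne_zero]
  simp

theorem IsYoung.coe_invQuotient (h : IsYoung Φ) (n : ℕ) (lam : ℝ) {r : ℝ≥0} (hr : 0 < r) :
    invQuotient n lam Φ r = (invProfile Φ n r / invProfile Φ lam r : ℝ≥0) := by
  rw [invQuotient, ← h.coe_invProfile _ hr, ← h.coe_invProfile _ hr,
    ENNReal.coe_div (h.invProfile_pos lam hr).ne']

end Young

/-! ### Ball volumes versus powers of the radius -/

section Volume

theorem exists_volume_ball (n : ℕ) : ∃ ω : ℝ≥0, 0 < ω ∧ ∀ (x : Rn n) (r : ℝ≥0), 0 < r →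
    volume (Metric.ball x r) = (ω * r ^ n : ℝ≥0) := by
  have h1 : volume (Metric.ball (0 : Rn n) 1) ≠ ∞ := measure_ball_lt_top.ne
  have h0 : 0 < volume (Metric.ball (0 : Rn n) 1) := Metric.measure_ball_pos _ _ one_pos
  refine ⟨(volume (Metric.ball (0 : Rn n) 1)).toNNReal, ENNReal.toNNReal_pos h0.ne' h1,
    fun x r hr => ?_⟩
  rw [Measure.addHaar_ball_of_pos _ _ (by exact_mod_cast hr), ENNReal.coe_mul,
    ENNReal.coe_toNNReal h1, mul_comm, finrank_euclideanSpace_fin,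
    show (r : ℝ) ^ n = ((r ^ n : ℝ≥0) : ℝ) by push_cast; rfl, ENNReal.ofReal_coe_nnreal]

theorem IsYoung.exists_youngInv_volume {Φ : ℝ≥0 → ℝ≥0∞} (h : IsYoung Φ) {n : ℕ} (hn : 0 < n)
    (s : ℝ) : ∃ κ : ℝ≥0, 1 ≤ κ ∧ ∀ (x : Rn n) (r : ℝ≥0), 0 < r →
      youngInv Φ (volume (Metric.ball x r) ^ (-s / n)) ≤ κ * invProfile Φ s r ∧
      invProfile Φ s r ≤ κ * youngInv Φ (volume (Metric.ball x r) ^ (-s / n)) := by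
  obtain ⟨ω, hω, hvol⟩ := exists_volume_ball n
  have key : ∀ c : ℝ≥0, 0 < c → ∀ t : ℝ≥0∞, youngInv Φ (c * t) ≤ (max 1 c : ℝ≥0) * youngInv Φ t :=
    fun c _ t => (youngInv_mono (by gcongr; exact le_max_right 1 c)).trans
      (h.youngInv_mul_le (le_max_left 1 c) t)
  set c : ℝ≥0 := ω ^ (-s / n)
  have hc : 0 < c := NNReal.rpow_pos hω
  refine ⟨max (max 1 c) (max 1 c⁻¹), (le_max_left 1 c).trans (le_max_left _ _), fun x r hr => ?_⟩
  have hv : volume (Metric.ball x (r : ℝ)) ^ (-s / n) = c * (r : ℝ≥0∞) ^ (-s) := by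
    rw [hvol x r hr, ← ENNReal.coe_rpow_of_ne_zero (by positivity),
      ← ENNReal.coe_rpow_of_ne_zero hr.ne', ← ENNReal.coe_mul, NNReal.mul_rpow,
      ← NNReal.rpow_natCast r n, ← NNReal.rpow_mul]
    congr 3
    field_simp
  rw [hv, h.coe_invProfile s hr]
  constructor
  · refine (key c hc _).trans ?_
    exact mul_le_mul_left (by exact_mod_cast le_max_left _ _) _
  · have := key c⁻¹ (inv_pos.2 hc) (c * (r : ℝ≥0∞) ^ (-s))
    rw [← mul_assoc, ← ENNReal.coe_mul, inv_mul_cancel₀ hc.ne', ENNReal.coe_one, one_mul] at this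
    refine this.trans ?_
    exact mul_le_mul_left (by exact_mod_cast le_max_right _ _) _

theorem IsYoung.exists_map_mul_volume {Φ : ℝ≥0 → ℝ≥0∞} (h : IsYoung Φ) {n : ℕ} (hn : 0 < n) :
    ∃ κ : ℝ≥0, 1 ≤ κ ∧ ∀ (x : Rn n) (r : ℝ≥0), 0 < r → ∀ u : ℝ≥0,
      (κ * u ≤ invProfile Φ n r → Φ u * volume (Metric.ball x r) ≤ 1) ∧
      (Φ u * volume (Metric.ball x r) ≤ 1 → u ≤ κ * invProfile Φ n r) := by
  obtain ⟨κ, hκ, H⟩ := h.exists_youngInv_volume hn n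
  have hκ0 : 0 < κ := one_pos.trans_le hκ
  -- The factor 2 supplies the strict inequality `u < Φ⁻¹(1/|B|)` needed by `le_of_lt_youngInv`.
  refine ⟨2 * κ, by linarith [hκ, hκ0], fun x r hr u => ?_⟩
  have hn' : -(n : ℝ) / n = -1 := by field_simp
  obtain ⟨h1, h2⟩ := H x r hr
  rw [hn', ENNReal.rpow_neg_one] at h1 h2
  have hv0 : volume (Metric.ball x (r : ℝ)) ≠ 0 := (Metric.measure_ball_pos _ _ (by simpa)).ne'
  have hvt : volume (Metric.ball x (r : ℝ)) ≠ ∞ := measure_ball_lt_top.ne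
  constructor
  · intro hu
    have hp := h.invProfile_pos n hr
    rw [← ENNReal.le_inv_iff_mul_le]
    apply le_of_lt_youngInv
    rw [← ENNReal.mul_lt_mul_iff_right (a := (κ : ℝ≥0∞)) (by simpa using hκ0.ne') (by simp)]
    refine lt_of_lt_of_le ?_ h2
    rw [← ENNReal.coe_mul, ENNReal.coe_lt_coe]
    rcases eq_or_ne u 0 with rfl | hu0
    · simpa using hp
    · have : 0 < κ * u := mul_pos hκ0 (pos_iff_ne_zero.2 hu0)
      refine lt_of_lt_of_le ?_ hu
      rw [mul_assoc]
      exact lt_mul_of_one_lt_left this one_lt_two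
  · intro hu
    rw [← ENNReal.le_inv_iff_mul_le] at hu
    have := (h.le_youngInv hu).trans h1
    rw [← ENNReal.coe_mul, ENNReal.coe_le_coe] at this
    refine this.trans ?_
    gcongr
    exact le_mul_of_one_le_left (zero_le) one_le_two

end Volume

/-! ### Averages controlled by modulars, and the Vitali covering -/

section Averages

variable {Φ : ℝ≥0 → ℝ≥0∞}

/-- A substitute for Jensen's inequality. -/
theorem IsYoung.map_mul_measure_le_lintegral (h : IsYoung Φ) {X : Type*} [MeasurableSpace X]
    {ν : Measure X} [IsFiniteMeasure ν] {u : X → ℝ≥0} {s : ℝ≥0} (hs : 0 < s)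
    (hu : 2 * s * ν univ < ∫⁻ x, u x ∂ν) : Φ s * ν univ ≤ ∫⁻ x, Φ (u x) ∂ν := by
  -- The part of `u` below height `s` contributes at most `s * ν univ`, less than half of the
  -- integral. On the remaining part `Φ(u) / u ≥ Φ(s) / s`.
  set v : X → ℝ≥0∞ := {x | s < u x}.indicator fun x => (u x : ℝ≥0∞)
  have h1 : ∫⁻ x, u x ∂ν ≤ s * ν univ + ∫⁻ x, v x ∂ν := by
    rw [← lintegral_const, ← lintegral_add_left measurable_const]
    refine lintegral_mono fun x => ?_
    by_cases hx : s < u x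
    · simp [v, hx]
    · simpa [v, hx] using not_lt.1 hx
  have h2 : s * ν univ ≤ ∫⁻ x, v x ∂ν := by
    have := hu.trans_le h1
    rw [mul_assoc, two_mul] at this
    exact (lt_of_add_lt_add_left this).le
  have h3 : Φ s * ∫⁻ x, v x ∂ν ≤ s * ∫⁻ x, Φ (u x) ∂ν := by
    rw [← lintegral_const_mul' _ _ ENNReal.coe_ne_top]
    refine (lintegral_const_mul_le _ _).trans (lintegral_mono fun x => ?_)
    by_cases hx : s < u x
    · simpa [v, hx, mul_comm (Φ s)] using h.mul_map_le hx.le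
    · simp [v, hx]
  rw [← ENNReal.mul_le_mul_iff_right (a := (s : ℝ≥0∞)) (by simpa using hs.ne') (by simp)]
  calc s * (Φ s * ν univ) = Φ s * (s * ν univ) := by ring
    _ ≤ Φ s * ∫⁻ x, v x ∂ν := by gcongr
    _ ≤ _ := h3

theorem IsYoung.exists_lintegral_ball_le (h : IsYoung Φ) {n : ℕ} (hn : 0 < n) :
    ∃ κ : ℝ≥0, 1 ≤ κ ∧ ∀ (x : Rn n) (r : ℝ≥0), 0 < r → ∀ u : Rn n → ℝ≥0,
      ∫⁻ y in Metric.ball x r, Φ (u y) ≤ 1 →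
      ∫⁻ y in Metric.ball x r, u y ≤ (κ * invProfile Φ n r : ℝ≥0) * volume (Metric.ball x r) := by
  obtain ⟨κ, hκ, H⟩ := h.exists_map_mul_volume hn
  have hκ0 : 0 < κ := one_pos.trans_le hκ
  -- One factor 2 is lost in the Jensen substitute; the other makes the final contradiction `2κa ≤
  -- κa` with `κa > 0`.
  refine ⟨2 * (2 * κ), by linarith, fun x r hr u hu => ?_⟩
  have ha := h.invProfile_pos n hr
  by_contra! hlt
  have hp : 0 < κ * invProfile Φ n r := mul_pos hκ0 ha
  have : IsFiniteMeasure (volume.restrict (Metric.ball x (r : ℝ))) :=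
    ⟨by rw [Measure.restrict_apply_univ]; exact measure_ball_lt_top⟩
  have h1 := h.map_mul_measure_le_lintegral (ν := volume.restrict (Metric.ball x r)) (u := u)
    (s := 2 * κ * invProfile Φ n r) (by rw [mul_assoc]; exact mul_pos two_pos hp) (by
      rw [Measure.restrict_apply_univ]
      convert hlt using 2
      push_cast; ring)
  rw [Measure.restrict_apply_univ] at h1
  have h2 := (H x r hr _).2 (h1.trans hu)
  rw [mul_assoc] at h2
  exact absurd h2 (not_le.2 (lt_mul_of_one_lt_left hp one_lt_two))

/-- The weak-type argument for the maximal function, done with the modular: select disjoint balls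
whose fivefold enlargements cover `E`, apply the Jensen substitute on each, and sum over the
disjoint family inside `U`. -/
theorem IsYoung.map_mul_volume_le_of_cover (h : IsYoung Φ) {n : ℕ} {u : Rn n → ℝ≥0} {s : ℝ≥0}
    (hs : 0 < s) {E U : Set (Rn n)} {ρ : Rn n → ℝ≥0} {R : ℝ≥0} (hρ : ∀ x ∈ E, 0 < ρ x)
    (hR : ∀ x ∈ E, ρ x ≤ R) (hU : ∀ x ∈ E, Metric.ball x (ρ x) ⊆ U)
    (hE : ∀ x ∈ E, 2 * s * volume (Metric.ball x (ρ x)) < ∫⁻ y in Metric.ball x (ρ x), u y) :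
    Φ s * volume E ≤ 5 ^ n * ∫⁻ y in U, Φ (u y) := by
  obtain ⟨ω, hω, hvol⟩ := exists_volume_ball n
  obtain ⟨v, hvE, hdisj, hcov⟩ := Vitali.exists_disjoint_subfamily_covering_enlargement_ball E
    (fun x => x) (fun x => (ρ x : ℝ)) R (fun x hx => hR x hx) 5 (by norm_num)
  have hcount : v.Countable := hdisj.countable_of_isOpen (fun _ _ => Metric.isOpen_ball)
    fun x hx => Metric.nonempty_ball.2 (hρ x (hvE hx))
  have hEv : E ⊆ ⋃ b ∈ v, Metric.ball b (5 * (ρ b : ℝ)) := by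
    intro x hx
    obtain ⟨b, hb, hsub⟩ := hcov x hx
    exact mem_biUnion hb (hsub (Metric.mem_ball_self (hρ x hx)))
  have h5 : ∀ b ∈ v, volume (Metric.ball b (5 * (ρ b : ℝ))) =
      5 ^ n * volume (Metric.ball b (ρ b)) := by
    intro b hb
    have h0 := hρ b (hvE hb)
    have := hvol b (5 * ρ b) (by positivity)
    push_cast at this
    rw [this, hvol b _ h0]
    push_cast
    ring
  have hball : ∀ b ∈ v, Φ s * volume (Metric.ball b (ρ b)) ≤
      ∫⁻ y in Metric.ball b (ρ b), Φ (u y) := by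
    intro b hb
    have : IsFiniteMeasure (volume.restrict (Metric.ball b (ρ b : ℝ))) :=
      ⟨by rw [Measure.restrict_apply_univ]; exact measure_ball_lt_top⟩
    have := h.map_mul_measure_le_lintegral (ν := volume.restrict (Metric.ball b (ρ b))) (u := u)
      hs (by rw [Measure.restrict_apply_univ]; exact hE b (hvE hb))
    rwa [Measure.restrict_apply_univ] at this
  calc Φ s * volume E ≤ Φ s * ∑' b : v, volume (Metric.ball b.1 (5 * (ρ b : ℝ))) := by
        gcongr
        exact (measure_mono hEv).trans (measure_biUnion_le _ hcount _)
    _ = ∑' b : v, 5 ^ n * (Φ s * volume (Metric.ball b.1 (ρ b))) := by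
        rw [← ENNReal.tsum_mul_left]
        refine tsum_congr fun b => ?_
        rw [h5 b b.2]
        ring
    _ ≤ ∑' b : v, 5 ^ n * ∫⁻ y in Metric.ball b.1 (ρ b), Φ (u y) :=
        ENNReal.tsum_le_tsum fun b => by gcongr; exact hball b b.2
    _ = 5 ^ n * ∫⁻ y in ⋃ b ∈ v, Metric.ball b (ρ b), Φ (u y) := by
        rw [ENNReal.tsum_mul_left, lintegral_biUnion hcount (fun _ _ => measurableSet_ball) hdisj]
    _ ≤ _ := by
        gcongr
        exact iUnion₂_subset fun b hb => hU b (hvE hb)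

end Averages

/-! ### Weak-type estimate for the Hardy–Littlewood maximal function -/

section Maximal

variable {Φ Ψ : ℝ≥0 → ℝ≥0∞} {n : ℕ}

theorem IsYoung.exists_lintegral_ball_le_morrey (h : IsYoung Φ) (hn : 0 < n) (lam : ℝ) :
    ∃ κ : ℝ≥0, 1 ≤ κ ∧ ∀ N : ℝ≥0, 0 < N → ∀ f : Rn n → ℝ≥0,
      (∀ (x : Rn n) (r : ℝ≥0), 0 < r →
        ∫⁻ y in Metric.ball x r, Φ (invProfile Φ lam r / N * f y) ≤ 1) →
      ∀ (x : Rn n) (r : ℝ≥0), 0 < r → ∫⁻ y in Metric.ball x r, f y ≤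
        (κ * N * (invProfile Φ n r / invProfile Φ lam r) : ℝ≥0) * volume (Metric.ball x r) := by
  obtain ⟨κ, hκ, H⟩ := h.exists_lintegral_ball_le hn
  refine ⟨κ, hκ, fun N hN f hf x r hr => ?_⟩
  have hw := h.invProfile_pos lam hr
  have h1 := H x r hr _ (hf x r hr)
  simp_rw [ENNReal.coe_mul] at h1
  rw [lintegral_const_mul' _ _ ENNReal.coe_ne_top] at h1
  have hc : 0 < invProfile Φ lam r / N := div_pos hw hN
  rw [← ENNReal.mul_le_mul_iff_right (a := ((invProfile Φ lam r / N : ℝ≥0) : ℝ≥0∞))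
    (by simpa using hc.ne') (by simp)]
  refine h1.trans_eq ?_
  rw [← mul_assoc, ← ENNReal.coe_mul, ← ENNReal.coe_mul]
  congr 2
  field_simp

/-- The threshold `K ≈ N q(r)` separates two regimes. Below it, the trivial bound by the whole ball
is already good enough. Above it, no ball of radius exceeding `r` can have average larger than `τ`,
so the problem is local to `B(x, 2r)` and the covering estimate applies. -/
theorem IsYoung.exists_weak_type (h : IsYoung Φ) (hn : 0 < n) {lam : ℝ} (hlam : 0 ≤ lam) {C₀ : ℝ≥0}
    (hQ : ∀ r ρ : ℝ≥0, 0 < r → r ≤ ρ → invProfile Φ n ρ / invProfile Φ lam ρ ≤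
      C₀ * (invProfile Φ n r / invProfile Φ lam r)) :
    ∃ C : ℝ≥0, 0 < C ∧ ∀ N : ℝ≥0, 0 < N → ∀ f : Rn n → ℝ≥0,
      (∀ (x : Rn n) (r : ℝ≥0), 0 < r →
        ∫⁻ y in Metric.ball x r, Φ (invProfile Φ lam r / N * f y) ≤ 1) →
      ∀ (x : Rn n) (r τ : ℝ≥0), 0 < r → 0 < τ →
        Φ (τ * invProfile Φ lam r / (C * N)) * volume {y ∈ Metric.ball x r | ∃ ρ : ℝ≥0, 0 < ρ ∧
          τ * volume (Metric.ball y ρ) < ∫⁻ z in Metric.ball y ρ, f z} ≤ 1 := by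
  obtain ⟨κ, hκ, hav⟩ := h.exists_lintegral_ball_le_morrey hn lam
  obtain ⟨κ₁, hκ₁, H⟩ := h.exists_map_mul_volume hn
  -- The first summand serves the covering regime (half from Jensen, doubling of `w`, Vitali
  -- constant), the second the small-`τ` regime.
  refine ⟨2 * 2 ^ lam * 5 ^ n + κ₁ * κ * C₀, by positivity, fun N hN f hf x r τ hr hτ => ?_⟩
  set C := 2 * 2 ^ lam * 5 ^ n + κ₁ * κ * C₀
  have hC : 0 < C := by positivity
  have hw := h.invProfile_pos lam hr
  have hw2 := h.invProfile_pos lam (mul_pos two_pos hr)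
  set K := κ * N * (C₀ * (invProfile Φ n r / invProfile Φ lam r)) with hK
  rcases lt_or_ge τ K with hτK | hτK
  · refine le_trans (mul_le_mul_right (measure_mono (sep_subset _ _)) _)
      ((H x r hr _).1 ?_)
    calc κ₁ * (τ * invProfile Φ lam r / (C * N)) ≤ κ₁ * (K * invProfile Φ lam r / (C * N)) := by
          gcongr
      _ = (κ₁ * κ * C₀) / C * invProfile Φ n r := by rw [hK]; field_simp
      _ ≤ 1 * invProfile Φ n r := by
          gcongr
          exact div_le_one_of_le₀ (le_add_of_nonneg_left (zero_le)) (zero_le)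
      _ = _ := one_mul _
  · set E := {y ∈ Metric.ball x r | ∃ ρ : ℝ≥0, 0 < ρ ∧
          τ * volume (Metric.ball y ρ) < ∫⁻ z in Metric.ball y ρ, f z} with hE
    have hEρ : ∀ y : Rn n, ∃ ρ : ℝ≥0, y ∈ E → 0 < ρ ∧ ρ ≤ r ∧
        τ * volume (Metric.ball y ρ) < ∫⁻ z in Metric.ball y ρ, f z := by
      intro y
      by_cases hy : y ∈ E
      · obtain ⟨-, ρ, hρ, hlt⟩ := hy
        refine ⟨ρ, fun _ => ⟨hρ, ?_, hlt⟩⟩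
        by_contra! hrρ
        refine hlt.not_ge ((hav N hN f hf y ρ hρ).trans ?_)
        gcongr
        refine le_trans ?_ hτK
        rw [hK]
        gcongr
        exact hQ r ρ hr hrρ.le
      · exact ⟨0, fun h => absurd h hy⟩
    choose ρ hρ using hEρ
    set c := invProfile Φ lam (2 * r) / N
    have hc : 0 < c := div_pos hw2 hN
    have h1 := h.map_mul_volume_le_of_cover (E := E) (U := Metric.ball x ((2 * r : ℝ≥0) : ℝ))
      (u := fun y => c * f y) (s := τ * c / 2) (ρ := ρ) (R := r) (by positivity)
      (fun y hy => (hρ y hy).1) (fun y hy => (hρ y hy).2.1) ?_ ?_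
    · have h2 : Φ (τ * c / 2) * volume E ≤ 5 ^ n := by
        refine h1.trans ?_
        calc _ ≤ (5 : ℝ≥0∞) ^ n * 1 := by
              gcongr
              exact hf x (2 * r) (by positivity)
          _ = _ := mul_one _
      -- The Vitali factor `5 ^ n` is moved inside `Φ`, where convexity gives `Φ(5^{-n} u) ≤ 5^{-n}
      -- Φ(u)`.
      have h3 : τ * invProfile Φ lam r / (C * N) ≤ (5 ^ n)⁻¹ * (τ * c / 2) := by
        calc τ * invProfile Φ lam r / (C * N)
            ≤ τ * (2 ^ lam * invProfile Φ lam (2 * r)) / ((2 * 2 ^ lam * 5 ^ n) * N) := by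
              gcongr
              · exact h.invProfile_le_two_mul hlam hr
              · exact le_add_of_nonneg_right (zero_le)
          _ = _ := by
              have : (2 : ℝ≥0) ^ lam ≠ 0 := (NNReal.rpow_pos two_pos).ne'
              simp only [c]
              field_simp
      calc _ ≤ ((5 ^ n)⁻¹ : ℝ≥0) * Φ (τ * c / 2) * volume E := by
            gcongr
            refine (h.mono h3).trans (h.map_mul_le ?_ _)
            exact inv_le_one_of_one_le₀ (one_le_pow₀ (by norm_num))
        _ ≤ ((5 ^ n)⁻¹ : ℝ≥0) * 5 ^ n := by
            rw [mul_assoc]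
            gcongr
        _ = 1 := by
            have : (5 : ℝ≥0∞) ^ n = ((5 ^ n : ℝ≥0) : ℝ≥0∞) := by push_cast; rfl
            rw [this, ← ENNReal.coe_mul, inv_mul_cancel₀ (by positivity), ENNReal.coe_one]
    · intro y hy
      apply Metric.ball_subset_ball'
      have h1 : dist y x < r := hy.1
      have h2 : (ρ y : ℝ) ≤ r := (hρ y hy).2.1
      push_cast
      linarith
    · intro y hy
      have h1 := (hρ y hy).2.2
      simp_rw [ENNReal.coe_mul]
      rw [lintegral_const_mul' _ _ ENNReal.coe_ne_top]
      have h2 := (ENNReal.mul_lt_mul_iff_right (a := (c : ℝ≥0∞)) (by simpa using hc.ne')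
        (by simp)).2 h1
      refine lt_of_eq_of_lt ?_ h2
      rw [← mul_assoc]
      congr 1
      norm_cast
      field_simp

end Maximal

/-! ### Hedberg-type inequality and the distribution of `M_α f` -/

section Distribution

variable {Φ Ψ : ℝ≥0 → ℝ≥0∞} {n : ℕ} {F : Type*} [NormedAddCommGroup F]

theorem lt_fracMaximal_iff {α : ℝ} {f : Rn n → F} {x : Rn n} {t : ℝ≥0∞} :
    t < fracMaximal α f x ↔ ∃ ρ : ℝ≥0, 0 < ρ ∧ t < volume (Metric.ball x ρ) ^ (-1 + α / n) *
      ∫⁻ y in Metric.ball x ρ, ‖f y‖ₑ := by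
  simp only [fracMaximal, lt_iSup_iff]
  constructor
  · rintro ⟨ρ, hρ, h⟩
    exact ⟨⟨ρ, hρ.le⟩, hρ, h⟩
  · rintro ⟨ρ, hρ, h⟩
    exact ⟨ρ, hρ, h⟩

/-- The inequality `M_α f ≤ C N^{1-β} (M f)^β` in level-set form: the same ball that witnesses `M_α
f > t` witnesses a large ordinary average. -/
theorem IsYoung.exists_average_of_lt_fracMaximal (h : IsYoung Φ) (hn : 0 < n) {α lam β : ℝ}
    (hβ : 0 < β) (hβ1 : β < 1) {C₀ : ℝ≥0} (hC₀ : 0 < C₀)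
    (hcond : ∀ t : ℝ≥0, 0 < t →
      t ^ α ≤ C₀ * (invProfile Φ n t / invProfile Φ lam t) ^ (β - 1)) :
    ∃ C : ℝ≥0, 0 < C ∧ ∀ N : ℝ≥0, 0 < N → ∀ f : Rn n → F,
      (∀ (x : Rn n) (r : ℝ≥0), 0 < r →
        ∫⁻ y in Metric.ball x r, Φ (invProfile Φ lam r / N * ‖f y‖₊) ≤ 1) →
      ∀ (x : Rn n) (t : ℝ≥0), t < fracMaximal α f x → ∃ ρ : ℝ≥0, 0 < ρ ∧
        ((t / (C * N ^ (1 - β))) ^ (1 / β) : ℝ≥0) * volume (Metric.ball x ρ) <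
          ∫⁻ y in Metric.ball x ρ, ‖f y‖₊ := by
  obtain ⟨κ, hκ, hav⟩ := h.exists_lintegral_ball_le_morrey hn lam
  obtain ⟨ω, hω, hvol⟩ := exists_volume_ball n
  have hκ0 : 0 < κ := one_pos.trans_le hκ
  have hω' : 0 < ω ^ (α / n) := NNReal.rpow_pos hω
  have hκ' : 0 < κ ^ (1 - β) := NNReal.rpow_pos hκ0
  refine ⟨ω ^ (α / n) * C₀ * κ ^ (1 - β), by positivity, fun N hN f hf x t ht => ?_⟩
  obtain ⟨ρ, hρ, hlt⟩ := lt_fracMaximal_iff.1 ht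
  have hN' : 0 < N ^ (1 - β) := NNReal.rpow_pos hN
  refine ⟨ρ, hρ, ?_⟩
  have hI := hav N hN _ hf x ρ hρ
  simp only [enorm_eq_nnnorm] at hlt
  have hc := hcond ρ hρ
  have hq : 0 < invProfile Φ n ρ / invProfile Φ lam ρ :=
    div_pos (h.invProfile_pos _ hρ) (h.invProfile_pos _ hρ)
  generalize invProfile Φ n ρ / invProfile Φ lam ρ = q at hI hc hq
  have hV : 0 < ω * ρ ^ n := by positivity
  rw [hvol x ρ hρ] at hlt hI ⊢
  set V := ω * ρ ^ n with hVdef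
  -- The Morrey bound makes the average `A` finite, so the rest is arithmetic in `ℝ≥0`.
  obtain ⟨A, hA⟩ : ∃ A : ℝ≥0, ∫⁻ y in Metric.ball x ρ, (‖f y‖₊ : ℝ≥0∞) = (A * V : ℝ≥0) := by
    have hne : ∫⁻ y in Metric.ball x ρ, (‖f y‖₊ : ℝ≥0∞) ≠ ∞ :=
      (hI.trans_lt (by rw [← ENNReal.coe_mul]; exact ENNReal.coe_lt_top)).ne
    refine ⟨(∫⁻ y in Metric.ball x ρ, (‖f y‖₊ : ℝ≥0∞)).toNNReal / V, ?_⟩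
    rw [div_mul_cancel₀ _ hV.ne', ENNReal.coe_toNNReal hne]
  rw [hA] at hlt hI ⊢
  rw [← ENNReal.coe_mul, ENNReal.coe_le_coe, mul_le_mul_iff_left₀ hV] at hI
  rw [← ENNReal.coe_rpow_of_ne_zero hV.ne', ← ENNReal.coe_mul, ENNReal.coe_lt_coe] at hlt
  rw [← ENNReal.coe_mul, ENNReal.coe_lt_coe]
  refine mul_lt_mul_of_pos_right ?_ hV
  have hVα : V ^ (-1 + α / n) * (A * V) = ω ^ (α / n) * ρ ^ α * A := by
    have h1 : V ^ (-1 + α / n) = V⁻¹ * (ω ^ (α / n) * ρ ^ α) := by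
      rw [NNReal.rpow_add hV.ne', NNReal.rpow_neg_one]
      congr 1
      rw [hVdef, NNReal.mul_rpow, ← NNReal.rpow_natCast ρ n, ← NNReal.rpow_mul]
      congr 2
      field_simp
    rw [h1]
    field_simp
  rw [hVα] at hlt
  have hA0 : 0 < A := by
    rw [pos_iff_ne_zero]
    rintro rfl
    simp at hlt
  -- Interpolation: split `A = A^{1-β} A^β` and use `A ≤ κ N q` on the first factor only.
  have hqA : q ^ (β - 1) * A ≤ (κ * N) ^ (1 - β) * A ^ β := by
    have h1 : q ^ (β - 1) * A = (A / q) ^ (1 - β) * A ^ β := by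
      rw [NNReal.div_rpow, div_mul_eq_mul_div, ← NNReal.rpow_add hA0.ne', div_eq_mul_inv,
        ← NNReal.rpow_neg, mul_comm]
      congr 1
      · simp
      · congr 1
        ring
    rw [h1]
    refine mul_le_mul_left (NNReal.rpow_le_rpow ?_ (by linarith)) _
    rw [div_le_iff₀ hq]
    exact hI
  have hfin : t / (ω ^ (α / n) * C₀ * κ ^ (1 - β) * N ^ (1 - β)) < A ^ β := by
    rw [div_lt_iff₀ (by positivity)]
    calc t < ω ^ (α / n) * ρ ^ α * A := hlt
      _ ≤ ω ^ (α / n) * (C₀ * q ^ (β - 1)) * A := by gcongr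
      _ = ω ^ (α / n) * C₀ * (q ^ (β - 1) * A) := by ring
      _ ≤ ω ^ (α / n) * C₀ * ((κ * N) ^ (1 - β) * A ^ β) := by gcongr
      _ = _ := by rw [NNReal.mul_rpow]; ring
  calc _ < (A ^ β) ^ (1 / β) := NNReal.rpow_lt_rpow hfin (by positivity)
    _ = A := by rw [← NNReal.rpow_mul, mul_one_div_cancel hβ.ne', NNReal.rpow_one]

theorem IsYoung.exists_distrib_fracMaximal_le (h : IsYoung Φ) (hn : 0 < n) {α lam β : ℝ}
    (hlam : 0 ≤ lam) (hβ : 0 < β) (hβ1 : β < 1) (hΨ : ∀ t : ℝ≥0, Ψ t = Φ (t ^ (1 / β)))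
    {C₀ C₁ : ℝ≥0} (hC₀ : 0 < C₀)
    (hcond : ∀ t : ℝ≥0, 0 < t →
      t ^ α ≤ C₀ * (invProfile Φ n t / invProfile Φ lam t) ^ (β - 1))
    (hQ : ∀ r ρ : ℝ≥0, 0 < r → r ≤ ρ → invProfile Φ n ρ / invProfile Φ lam ρ ≤
      C₁ * (invProfile Φ n r / invProfile Φ lam r)) :
    ∃ C : ℝ≥0, 0 < C ∧ ∀ N : ℝ≥0, 0 < N → ∀ f : Rn n → F,
      (∀ (x : Rn n) (r : ℝ≥0), 0 < r →
        ∫⁻ y in Metric.ball x r, Φ (invProfile Φ lam r / N * ‖f y‖₊) ≤ 1) →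
      ∀ (x : Rn n) (r t : ℝ≥0), 0 < r → 0 < t →
        Ψ (t / (C * N / invProfile Φ lam r ^ β)) *
          distrib ((Metric.ball x r).indicator (fracMaximal α f)) t ≤ 1 := by
  obtain ⟨C₂, hC₂, H₂⟩ := h.exists_average_of_lt_fracMaximal (F := F) hn hβ hβ1 hC₀ hcond
  obtain ⟨C₃, hC₃, H₃⟩ := h.exists_weak_type hn hlam hQ
  have hC₃' : 0 < C₃ ^ β := NNReal.rpow_pos hC₃
  refine ⟨C₂ * C₃ ^ β, by positivity, fun N hN f hf x r t hr ht => ?_⟩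
  have hN' : 0 < N ^ (1 - β) := NNReal.rpow_pos hN
  have hNβ : 0 < N ^ β := NNReal.rpow_pos hN
  have hw := h.invProfile_pos lam hr
  have hwβ : 0 < invProfile Φ lam r ^ β := NNReal.rpow_pos hw
  set τ := (t / (C₂ * N ^ (1 - β))) ^ (1 / β) with hτdef
  have hτ : 0 < τ := NNReal.rpow_pos (by positivity)
  -- With `N = N^{1-β} N^β`, the power `1/β` in `Ψ` turns the scale for `M_α f` at level `t` into
  -- the scale of the weak-type estimate at level `τ`.
  have h1 : (t / (C₂ * C₃ ^ β * N / invProfile Φ lam r ^ β)) ^ (1 / β) =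
      τ * invProfile Φ lam r / (C₃ * N) := by
    have h2 : t / (C₂ * C₃ ^ β * N / invProfile Φ lam r ^ β) =
        t / (C₂ * N ^ (1 - β)) * (invProfile Φ lam r / (C₃ * N)) ^ β := by
      have : N = N ^ (1 - β) * N ^ β := by
        rw [← NNReal.rpow_add hN.ne']
        simp
      rw [NNReal.div_rpow, NNReal.mul_rpow]
      nth_rewrite 1 [this]
      field_simp
    rw [h2, NNReal.mul_rpow, ← NNReal.rpow_mul, mul_one_div_cancel hβ.ne', NNReal.rpow_one, hτdef,
      mul_div_assoc]
  rw [hΨ, h1]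
  refine le_trans (mul_le_mul_right (measure_mono ?_) _) (H₃ N hN _ hf x r τ hr hτ)
  intro y hy
  by_cases hyB : y ∈ Metric.ball x (r : ℝ)
  · refine ⟨hyB, H₂ N hN f hf y t ?_⟩
    simpa [hyB] using hy
  · simp [hyB] at hy

end Distribution

/-! ### Measurability of `M_α f`, and weak `L^p` inside `L^1` -/

section Measurability

variable {n : ℕ} {F : Type*} [NormedAddCommGroup F]

/-- An open ball is the increasing union of smaller concentric balls, and a slightly smaller ball
stays inside the ball of the same radius `t` about any nearby centre. -/
theorem lowerSemicontinuous_measure_ball {X : Type*} [PseudoMetricSpace X] [MeasurableSpace X]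
    (μ : Measure X) (t : ℝ) : LowerSemicontinuous fun x => μ (Metric.ball x t) := by
  intro x c hc
  have h1 : Metric.ball x t = ⋃ k : ℕ, Metric.ball x (t - 1 / ((k : ℝ) + 1)) := by
    ext y
    simp only [Metric.mem_ball, mem_iUnion]
    constructor
    · intro hy
      obtain ⟨k, hk⟩ := exists_nat_one_div_lt (sub_pos.2 hy)
      exact ⟨k, by linarith⟩
    · rintro ⟨k, hk⟩
      have : 0 < 1 / ((k : ℝ) + 1) := by positivity
      linarith
  have hmono : Monotone fun k : ℕ => Metric.ball x (t - 1 / ((k : ℝ) + 1)) := fun i j hij =>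
    Metric.ball_subset_ball (sub_le_sub_left (Nat.one_div_le_one_div hij) _)
  dsimp only at hc
  rw [h1, hmono.measure_iUnion, gt_iff_lt, lt_iSup_iff] at hc
  obtain ⟨k, hk⟩ := hc
  have hpos : 0 < 1 / ((k : ℝ) + 1) := by positivity
  filter_upwards [Metric.ball_mem_nhds x hpos] with y hy
  refine hk.trans_le (measure_mono (Metric.ball_subset_ball' ?_))
  rw [Metric.mem_ball, dist_comm] at hy
  linarith

theorem measurable_fracMaximal (α : ℝ) (f : Rn n → F) : Measurable (fracMaximal α f) := by
  apply LowerSemicontinuous.measurable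
  refine lowerSemicontinuous_iSup fun t => lowerSemicontinuous_iSup fun ht => ?_
  -- Integrals of `‖f‖ₑ` over balls are ball measures for the density `‖f‖ₑ`, which needs no
  -- measurability of `f`.
  have h1 := lowerSemicontinuous_measure_ball (volume.withDensity fun y : Rn n => ‖f y‖ₑ) t
  simp_rw [withDensity_apply _ measurableSet_ball] at h1
  obtain ⟨ω, hω, hvol⟩ := exists_volume_ball n
  have h2 : ∀ x : Rn n, volume (Metric.ball x t) ^ (-1 + α / n) =
      ((ω * t.toNNReal ^ n) ^ (-1 + α / n) : ℝ≥0) := by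
    intro x
    have := hvol x t.toNNReal (Real.toNNReal_pos.2 ht)
    rw [Real.coe_toNNReal _ ht.le] at this
    rw [this, ENNReal.coe_rpow_of_ne_zero]
    have := Real.toNNReal_pos.2 ht
    positivity
  simp_rw [h2]
  exact (ENNReal.continuous_const_mul ENNReal.coe_ne_top).comp_lowerSemicontinuous h1
    (fun _ _ hab => mul_le_mul_right hab _)

/-- On a finite measure space weak `L^p` lies in `L^1` for `p > 1`: `g` is dominated by 1 plus the
dyadic layers `2^k χ_{g > 2^k}`, whose integrals decay like `2^{k(1-p)}`. -/
theorem lintegral_lt_top_of_rpow_mul_measure_le {X : Type*} [MeasurableSpace X] {μ : Measure X}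
    [IsFiniteMeasure μ] {g : X → ℝ≥0∞} (hg : Measurable g) {p : ℝ} (hp : 1 < p) {A : ℝ≥0}
    (hA : ∀ t : ℝ≥0, 0 < t → (t ^ p : ℝ≥0) * μ {x | t < g x} ≤ A) : ∫⁻ x, g x ∂μ < ∞ := by
  set v : ℕ → X → ℝ≥0∞ := fun k => {x | ((2 ^ k : ℝ≥0) : ℝ≥0∞) < g x}.indicator
    fun _ => ((2 ^ k : ℝ≥0) : ℝ≥0∞)
  have hmeas : ∀ k : ℕ, MeasurableSet {x | ((2 ^ k : ℝ≥0) : ℝ≥0∞) < g x} := fun k =>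
    measurableSet_lt measurable_const hg
  have hfin : ∀ (m : ℕ) x, min (g x) (2 ^ m) ≤ 1 + ∑ k ∈ Finset.range m, v k x := by
    intro m x
    induction m with
    | zero => simp
    | succ m ih =>
      rw [Finset.sum_range_succ, ← add_assoc]
      by_cases hx : ((2 ^ m : ℝ≥0) : ℝ≥0∞) < g x
      · have hv : v m x = 2 ^ m := by
          dsimp only [v]
          rw [indicator_of_mem (s := {x | ((2 ^ m : ℝ≥0) : ℝ≥0∞) < g x}) hx]
          push_cast
          rfl
        rw [hv]
        push_cast at hx
        rw [min_eq_right hx.le] at ih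
        refine (min_le_right _ _).trans ?_
        rw [pow_succ, mul_two]
        gcongr
      · have hx' : g x ≤ 2 ^ m := by simpa using hx
        rw [min_eq_left hx'] at ih
        exact (min_le_left _ _).trans (ih.trans le_self_add)
  have hle : ∀ x, g x ≤ 1 + ∑' k, v k x := by
    intro x
    have h2 : Tendsto (fun m : ℕ => min (g x) (2 ^ m)) atTop (𝓝 (min (g x) ∞)) :=
      tendsto_const_nhds.min (ENNReal.tendsto_pow_atTop_nhds_top_iff.2 (by norm_num))
    rw [min_eq_left le_top] at h2
    refine le_of_tendsto' h2 fun m => (hfin m x).trans ?_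
    gcongr
    exact ENNReal.sum_le_tsum _
  have hgeom : ∀ k : ℕ, ∫⁻ x, v k x ∂μ ≤ A * ((2 ^ (1 - p) : ℝ≥0) : ℝ≥0∞) ^ k := by
    intro k
    rw [lintegral_indicator_const (hmeas k)]
    have h1 := hA (2 ^ k) (by positivity)
    have h2 : (2 ^ k : ℝ≥0) = (2 ^ (1 - p)) ^ k * (2 ^ k) ^ p := by
      rw [← NNReal.rpow_natCast, ← NNReal.rpow_natCast, ← NNReal.rpow_mul, ← NNReal.rpow_mul,
        ← NNReal.rpow_add two_ne_zero]
      congr 1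
      ring
    calc ((2 ^ k : ℝ≥0) : ℝ≥0∞) * μ {x | ((2 ^ k : ℝ≥0) : ℝ≥0∞) < g x}
        = ((2 ^ (1 - p)) ^ k : ℝ≥0) *
            (((2 ^ k) ^ p : ℝ≥0) * μ {x | ((2 ^ k : ℝ≥0) : ℝ≥0∞) < g x}) := by
          rw [← mul_assoc, ← ENNReal.coe_mul, ← h2]
      _ ≤ ((2 ^ (1 - p)) ^ k : ℝ≥0) * A := by gcongr
      _ = _ := by rw [mul_comm, ENNReal.coe_pow]
  calc ∫⁻ x, g x ∂μ ≤ ∫⁻ x, (1 + ∑' k, v k x) ∂μ := lintegral_mono hle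
    _ = μ univ + ∑' k, ∫⁻ x, v k x ∂μ := by
        rw [lintegral_add_left measurable_const, lintegral_const, one_mul,
          lintegral_tsum fun k => (measurable_const.indicator (hmeas k)).aemeasurable]
    _ ≤ μ univ + ∑' k, A * ((2 ^ (1 - p) : ℝ≥0) : ℝ≥0∞) ^ k := by
        gcongr with k
        exact hgeom k
    _ < ∞ := by
        rw [ENNReal.tsum_mul_left, ENNReal.tsum_geometric]
        refine ENNReal.add_lt_top.2 ⟨measure_lt_top _ _, ENNReal.mul_lt_top ENNReal.coe_lt_top ?_⟩
        rw [ENNReal.inv_lt_top, tsub_pos_iff_lt]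
        exact_mod_cast NNReal.rpow_lt_one_of_one_lt_of_neg one_lt_two (by linarith)

end Measurability

/-! ### Sufficiency of the growth condition -/

section Sufficiency

variable {Φ Ψ : ℝ≥0 → ℝ≥0∞} {n : ℕ} {F : Type*} [NormedAddCommGroup F]

theorem le_orliczMorreyNorm {lam : ℝ} (f : Rn n → F) (x : Rn n) {r : ℝ} (hr : 0 < r) :
    youngInv Φ (volume (Metric.ball x r) ^ (-lam / n)) *
      orliczNorm Φ ((Metric.ball x r).indicator f) ≤ orliczMorreyNorm Φ lam f :=
  le_iSup_of_le x (le_iSup_of_le r (le_iSup_of_le hr le_rfl))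

theorem le_weakOrliczMorreyNorm {lam : ℝ} (g : Rn n → ℝ≥0∞) (x : Rn n) {r : ℝ} (hr : 0 < r) :
    youngInv Ψ (volume (Metric.ball x r) ^ (-lam / n)) *
      weakOrliczNorm Ψ ((Metric.ball x r).indicator g) ≤ weakOrliczMorreyNorm Ψ lam g :=
  le_iSup_of_le x (le_iSup_of_le r (le_iSup_of_le hr le_rfl))

theorem IsYoung.exists_lintegral_ball_le_one (h : IsYoung Φ) (hn : 0 < n) (lam : ℝ) :
    ∃ κ : ℝ≥0, 0 < κ ∧ ∀ (f : Rn n → F) (N : ℝ≥0), 0 < N → orliczMorreyNorm Φ lam f ≤ N →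
      ∀ (x : Rn n) (r : ℝ≥0), 0 < r →
        ∫⁻ y in Metric.ball x r, Φ (invProfile Φ lam r / (κ * N) * ‖f y‖₊) ≤ 1 := by
  obtain ⟨κ, hκ, H⟩ := h.exists_youngInv_volume hn lam
  have hκ0 : 0 < κ := one_pos.trans_le hκ
  -- The infimum in the Luxemburg norm need not be known to be attained; doubling leaves room for an
  -- admissible `l`.
  refine ⟨2 * κ, by positivity, fun f N hN hf x r hr => ?_⟩
  have hw := h.invProfile_pos lam hr
  have hκN : 0 < κ * N := by positivity
  set fB := (Metric.ball x (r : ℝ)).indicator f with hfB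
  have h1 : youngInv Φ (volume (Metric.ball x (r : ℝ)) ^ (-lam / n)) * orliczNorm Φ fB ≤ N :=
    (le_orliczMorreyNorm f x (NNReal.coe_pos.2 hr)).trans hf
  have h2 : invProfile Φ lam r * orliczNorm Φ fB ≤ (κ * N : ℝ≥0) := by
    calc _ ≤ κ * youngInv Φ (volume (Metric.ball x (r : ℝ)) ^ (-lam / n)) * orliczNorm Φ fB := by
          gcongr
          exact (H x r hr).2
      _ ≤ κ * N := by
          rw [mul_assoc]
          gcongr
      _ = _ := (ENNReal.coe_mul _ _).symm
  have h3 : orliczNorm Φ fB < ((2 * κ * N) / invProfile Φ lam r : ℝ≥0) := by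
    rw [mul_comm, ← ENNReal.le_div_iff_mul_le (by simp [hw.ne']) (by simp),
      ← ENNReal.coe_div hw.ne'] at h2
    refine h2.trans_lt (ENNReal.coe_lt_coe.2 ?_)
    rw [mul_assoc]
    exact div_lt_div_of_pos_right (lt_mul_of_one_lt_left hκN one_lt_two) hw
  simp only [orliczNorm, iInf_lt_iff] at h3
  obtain ⟨l, hl, hle, hlt⟩ := h3
  refine le_trans ?_ hle
  calc ∫⁻ y in Metric.ball x r, Φ (invProfile Φ lam r / (2 * κ * N) * ‖f y‖₊)
      ≤ ∫⁻ y in Metric.ball x r, Φ (‖fB y‖₊ / l) := by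
        refine setLIntegral_mono' measurableSet_ball fun y hy => h.mono ?_
        rw [hfB, indicator_of_mem hy, mul_comm, div_eq_mul_inv _ l]
        gcongr
        rw [le_inv_comm₀ (by positivity) hl, inv_div]
        exact_mod_cast hlt.le
    _ ≤ _ := setLIntegral_le_lintegral _ _

theorem weakOrliczNorm_le {g : Rn n → ℝ≥0∞} {l : ℝ≥0} (hl : 0 < l)
    (hg : ∀ t : ℝ≥0, 0 < t → Ψ (t / l) * distrib g t ≤ 1) : weakOrliczNorm Ψ g ≤ l :=
  iInf₂_le_of_le l hl (iInf_le _ (iSup₂_le hg))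

/-- Beyond a point `b` with `Φ(b) > 1`, monotonicity of `Φ(u)/u` forces growth at least `u / b`.
Hence `Ψ` dominates the power `1/β > 1` up to constants. -/
theorem IsYoung.exists_mul_le_one_add (h : IsYoung Φ) :
    ∃ b : ℝ≥0, 0 < b ∧ ∀ u : ℝ≥0, (u : ℝ≥0∞) ≤ b * (1 + Φ u) := by
  obtain ⟨b, hb⟩ := h.exists_lt ENNReal.one_ne_top
  have hb0 : 0 < b := by
    rw [pos_iff_ne_zero]
    rintro rfl
    simp [h.map_zero] at hb
  refine ⟨b, hb0, fun u => ?_⟩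
  rcases le_total u b with hu | hu
  · calc (u : ℝ≥0∞) ≤ b * 1 := by rw [mul_one]; exact_mod_cast hu
      _ ≤ _ := by gcongr; exact le_self_add
  · calc (u : ℝ≥0∞) = u * 1 := (mul_one _).symm
      _ ≤ u * Φ b := by gcongr
      _ ≤ b * Φ u := h.mul_map_le hu
      _ ≤ _ := by gcongr; exact le_add_self

/-- By the linear lower bound on `Φ`, the weak `Ψ` estimate on a ball implies a weak `L^{1/β}`
estimate there, and the ball has finite measure. This gives the local integrability built into the
target space. -/
theorem IsYoung.integrable_indicator_of_distrib (h : IsYoung Φ) {β : ℝ} (hβ : 0 < β)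
    (hβ1 : β < 1) (hΨ : ∀ t : ℝ≥0, Ψ t = Φ (t ^ (1 / β))) {g : Rn n → ℝ≥0∞} (hg : Measurable g)
    {x : Rn n} {r : ℝ} {l : ℝ≥0} (hl : 0 < l)
    (hd : ∀ t : ℝ≥0, 0 < t → Ψ (t / l) * distrib ((Metric.ball x r).indicator g) t ≤ 1) :
    Integrable ((Metric.ball x r).indicator g) volume := by
  obtain ⟨b, hb, hbΦ⟩ := h.exists_mul_le_one_add
  have hβ' : 0 < 1 / β := by positivity
  have hlβ : 0 < l ^ (1 / β) := NNReal.rpow_pos hl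
  set B := Metric.ball x r
  have hB : volume B ≠ ∞ := measure_ball_lt_top.ne
  have : IsFiniteMeasure (volume.restrict B) :=
    ⟨by rw [Measure.restrict_apply_univ]; exact measure_ball_lt_top⟩
  refine ⟨(hg.indicator measurableSet_ball).aestronglyMeasurable, ?_⟩
  rw [hasFiniteIntegral_iff_enorm]
  simp only [enorm_eq_self]
  rw [lintegral_indicator measurableSet_ball]
  refine lintegral_lt_top_of_rpow_mul_measure_le hg (p := 1 / β)
    (by rw [lt_div_iff₀ hβ]; linarith) (A := l ^ (1 / β) * (b * ((volume B).toNNReal + 1)))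
    fun t ht => ?_
  have hm : volume.restrict B {y | t < g y} = distrib (B.indicator g) t := by
    rw [Measure.restrict_apply (measurableSet_lt measurable_const hg), distrib]
    congr 1
    ext y
    by_cases hy : y ∈ B <;> simp [hy]
  have hmB : volume.restrict B {y | t < g y} ≤ volume B :=
    (measure_mono (subset_univ _)).trans_eq (Measure.restrict_apply_univ _)
  have h1 := hd t ht
  rw [← hm, hΨ] at h1
  set m := volume.restrict B {y | t < g y}
  have h2 : (t ^ (1 / β) : ℝ≥0) = l ^ (1 / β) * (t / l) ^ (1 / β) := by
    rw [← NNReal.mul_rpow, mul_div_cancel₀ _ hl.ne']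
  rw [h2]
  push_cast
  rw [ENNReal.coe_toNNReal hB, mul_assoc]
  refine mul_le_mul_right ?_ _
  calc (((t / l) ^ (1 / β) : ℝ≥0) : ℝ≥0∞) * m
      ≤ b * (1 + Φ ((t / l) ^ (1 / β))) * m := by gcongr; exact hbΦ _
    _ = b * (m + Φ ((t / l) ^ (1 / β)) * m) := by ring
    _ ≤ _ := by gcongr

theorem IsYoung.fracMaximalBounded_of_rpow_le {𝕜 : Type*} [RCLike 𝕜] (h : IsYoung Φ) (hn : 0 < n)
    {α lam β : ℝ} (hlam : 0 ≤ lam) (hβ : 0 < β) (hβ1 : β < 1)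
    (hΨ : ∀ t : ℝ≥0, Ψ t = Φ (t ^ (1 / β))) {C₀ C₁ : ℝ≥0} (hC₀ : 0 < C₀)
    (hcond : ∀ t : ℝ≥0, 0 < t →
      t ^ α ≤ C₀ * (invProfile Φ n t / invProfile Φ lam t) ^ (β - 1))
    (hQ : ∀ r ρ : ℝ≥0, 0 < r → r ≤ ρ → invProfile Φ n ρ / invProfile Φ lam ρ ≤
      C₁ * (invProfile Φ n r / invProfile Φ lam r)) :
    FracMaximalBounded 𝕜 n α lam Φ Ψ := by
  obtain ⟨κ, hκ, Hκ⟩ := h.exists_lintegral_ball_le_one (F := 𝕜) hn lam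
  obtain ⟨κ₁, hκ₁, Hκ₁⟩ := h.exists_youngInv_volume hn lam
  obtain ⟨C, hC, H⟩ := h.exists_distrib_fracMaximal_le (F := 𝕜) hn hlam hβ hβ1 hΨ hC₀ hcond hQ
  have hκ₁0 : 0 < κ₁ := one_pos.trans_le hκ₁
  have hκ₁β : 0 < κ₁ ^ β := NNReal.rpow_pos hκ₁0
  have hloc : ∀ (f : Rn n → 𝕜) (N : ℝ≥0), 0 < N → orliczMorreyNorm Φ lam f ≤ N →
      ∀ (x : Rn n) (r : ℝ≥0), 0 < r → ∀ t : ℝ≥0, 0 < t →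
        Ψ (t / (C * (κ * N) / invProfile Φ lam r ^ β)) *
          distrib ((Metric.ball x r).indicator (fracMaximal α f)) t ≤ 1 :=
    fun f N hN hf x r hr t ht => H (κ * N) (by positivity) f (Hκ f N hN hf) x r t hr ht
  have hpos : ∀ N : ℝ≥0, 0 < N → ∀ r : ℝ≥0, 0 < r →
      0 < C * (κ * N) / invProfile Φ lam r ^ β := fun N hN r hr =>
    div_pos (by positivity) (NNReal.rpow_pos (h.invProfile_pos lam hr))
  have hweak : ∀ (f : Rn n → 𝕜) (N : ℝ≥0), 0 < N → orliczMorreyNorm Φ lam f ≤ N →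
      weakOrliczMorreyNorm Ψ lam (fracMaximal α f) ≤ (κ₁ ^ β * C * κ : ℝ≥0) * N := by
    intro f N hN hf
    refine iSup_le fun x => iSup₂_le fun r hr => ?_
    lift r to ℝ≥0 using hr.le
    rw [NNReal.coe_pos] at hr
    have hw := h.invProfile_pos lam hr
    have hwβ : 0 < invProfile Φ lam r ^ β := NNReal.rpow_pos hw
    rw [youngInv_rpow hβ hΨ]
    calc _ ≤ ((κ₁ * invProfile Φ lam r : ℝ≥0) : ℝ≥0∞) ^ β *
          (C * (κ * N) / invProfile Φ lam r ^ β : ℝ≥0) := by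
          gcongr
          · rw [ENNReal.coe_mul]
            exact (Hκ₁ x r hr).1
          · exact weakOrliczNorm_le (hpos N hN r hr) (hloc f N hN hf x r hr)
      _ = _ := by
          rw [← ENNReal.coe_rpow_of_nonneg _ hβ.le, ← ENNReal.coe_mul, ← ENNReal.coe_mul,
            NNReal.mul_rpow]
          congr 1
          field_simp
  refine ⟨κ₁ ^ β * C * κ, fun f hf => ?_⟩
  set D := κ₁ ^ β * C * κ
  have hD : 0 < D := by positivity
  have hbound : weakOrliczMorreyNorm Ψ lam (fracMaximal α f) ≤ D * orliczMorreyNorm Φ lam f := by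
    rw [mul_comm, ← ENNReal.div_le_iff (by simpa using hD.ne') (by simp)]
    -- `hweak` requires a positive `N`; approximating the norm from above also covers norm zero.
    refine le_of_forall_gt_imp_ge_of_dense fun c hc => ?_
    rw [ENNReal.div_le_iff (by simpa using hD.ne') (by simp), mul_comm]
    rcases eq_or_ne c ∞ with rfl | hct
    · rw [ENNReal.mul_top (by simpa using hD.ne')]
      exact le_top
    lift c to ℝ≥0 using hct
    exact hweak f c (by exact_mod_cast (zero_le.trans_lt hc)) hc.le
  refine ⟨⟨fun x r hr => ?_, hbound.trans_lt (ENNReal.mul_lt_top (by simp) hf.2)⟩, hbound⟩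
  lift r to ℝ≥0 using hr.le
  rw [NNReal.coe_pos] at hr
  set N := (orliczMorreyNorm Φ lam f).toNNReal + 1
  have hN : 0 < N := by positivity
  have hfN : orliczMorreyNorm Φ lam f ≤ N := by
    rw [ENNReal.coe_add, ENNReal.coe_toNNReal hf.2.ne]
    exact le_self_add
  have hd := hloc f N hN hfN x r hr
  exact ⟨(h.integrable_indicator_of_distrib hβ hβ1 hΨ (measurable_fracMaximal α f)
    (hpos N hN r hr) hd).locallyIntegrable,
    (weakOrliczNorm_le (hpos N hN r hr) hd).trans_lt ENNReal.coe_lt_top⟩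

end Sufficiency

/-! ### Necessity: testing on indicators of balls -/

section Necessity

variable {Φ Ψ : ℝ≥0 → ℝ≥0∞} {n : ℕ} {𝕜 : Type*} [RCLike 𝕜]

theorem lintegral_map_indicator_one {A : Set (Rn n)} (hA : MeasurableSet A)
    {φ : ℝ≥0 → ℝ≥0∞} (hφ : φ 0 = 0) :
    ∫⁻ y, φ ‖A.indicator (fun _ => (1 : 𝕜)) y‖₊ = φ 1 * volume A := by
  rw [← lintegral_indicator_const hA]
  congr 1
  ext y
  by_cases hy : y ∈ A <;> simp [hy, hφ]

theorem IsYoung.memOrliczLoc_indicator_ball (h : IsYoung Φ) (z : Rn n) (t : ℝ) :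
    MemOrliczLoc Φ ((Metric.ball z t).indicator fun _ => (1 : 𝕜)) := by
  intro x r _
  rw [indicator_indicator]
  have hm : MeasurableSet (Metric.ball x r ∩ Metric.ball z t) :=
    measurableSet_ball.inter measurableSet_ball
  have hfin : volume (Metric.ball x r ∩ Metric.ball z t) < ∞ :=
    (measure_mono inter_subset_left).trans_lt measure_ball_lt_top
  constructor
  · exact ((integrable_indicator_iff hm).2 (integrableOn_const hfin.ne)).locallyIntegrable
  · obtain ⟨k, hk, hΦk⟩ := h.exists_pos_lt one_ne_zero
    refine ⟨k, hk, ?_⟩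
    rw [lintegral_map_indicator_one hm (φ := fun u => Φ (k * u)) (by simp [h.map_zero]), mul_one]
    exact ENNReal.mul_lt_top (hΦk.trans ENNReal.one_lt_top) hfin

/-- The intersection of two balls has at most the volume of a ball of radius `ρ = min r t`, so its
Orlicz norm is `≲ 1 / a(ρ)`. As `w` decreases, `w(r) / a(ρ) ≤ w(ρ) / a(ρ) = 1 / q(ρ)`, and `q`
almost decreasing moves this to `ρ = t`. -/
theorem IsYoung.exists_orliczMorreyNorm_indicator_ball_le (h : IsYoung Φ) (hn : 0 < n) {lam : ℝ}
    (hlam : 0 ≤ lam) {C₁ : ℝ≥0}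
    (hQ : ∀ r ρ : ℝ≥0, 0 < r → r ≤ ρ → invProfile Φ n ρ / invProfile Φ lam ρ ≤
      C₁ * (invProfile Φ n r / invProfile Φ lam r)) :
    ∃ C : ℝ≥0, ∀ (z : Rn n) (t : ℝ≥0), 0 < t →
      orliczMorreyNorm Φ lam ((Metric.ball z t).indicator fun _ => (1 : 𝕜)) ≤
        (C * (invProfile Φ lam t / invProfile Φ n t) : ℝ≥0) := by
  obtain ⟨κ, hκ, H⟩ := h.exists_youngInv_volume hn lam
  obtain ⟨κ₁, hκ₁, H₁⟩ := h.exists_map_mul_volume hn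
  have hκ₁0 : 0 < κ₁ := one_pos.trans_le hκ₁
  refine ⟨κ * κ₁ * C₁, fun z t ht => iSup_le fun x => iSup₂_le fun r hr => ?_⟩
  lift r to ℝ≥0 using hr.le
  rw [NNReal.coe_pos] at hr
  rw [indicator_indicator]
  have hρ : 0 < min r t := lt_min hr ht
  set ρ := min r t
  have ha := h.invProfile_pos n hρ
  have hw := h.invProfile_pos lam hρ
  have hat := h.invProfile_pos n ht
  have hwt := h.invProfile_pos lam ht
  have hm : MeasurableSet (Metric.ball x (r : ℝ) ∩ Metric.ball z t) :=
    measurableSet_ball.inter measurableSet_ball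
  have hvolle : volume (Metric.ball x (r : ℝ) ∩ Metric.ball z t) ≤
      volume (Metric.ball x (ρ : ℝ)) := by
    rcases le_total r t with hrt | hrt
    · simp only [ρ, min_eq_left hrt]
      exact measure_mono inter_subset_left
    · simp only [ρ, min_eq_right hrt]
      refine (measure_mono inter_subset_right).trans_eq ?_
      rw [Measure.addHaar_ball_center, ← Measure.addHaar_ball_center volume x]
  have hl : 0 < κ₁ / invProfile Φ n ρ := div_pos hκ₁0 ha
  have h1 : orliczNorm Φ ((Metric.ball x (r : ℝ) ∩ Metric.ball z t).indicator fun _ => (1 : 𝕜)) ≤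
      (κ₁ / invProfile Φ n ρ : ℝ≥0) := by
    refine iInf₂_le_of_le _ hl (iInf_le _ ?_)
    rw [lintegral_map_indicator_one hm (φ := fun u => Φ (u / (κ₁ / invProfile Φ n ρ)))
      (by simp [h.map_zero])]
    refine le_trans (mul_le_mul_right hvolle _) ((H₁ x ρ hρ _).1 ?_)
    rw [one_div_div, mul_div_cancel₀ _ hκ₁0.ne']
  calc _ ≤ (κ * invProfile Φ lam r : ℝ≥0) * ((κ₁ / invProfile Φ n ρ : ℝ≥0) : ℝ≥0∞) := by
        gcongr
        rw [ENNReal.coe_mul]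
        exact (H x r hr).1
    _ ≤ _ := by
        rw [← ENNReal.coe_mul, ENNReal.coe_le_coe]
        have hq := hQ ρ t hρ (min_le_right _ _)
        calc κ * invProfile Φ lam r * (κ₁ / invProfile Φ n ρ)
            ≤ κ * invProfile Φ lam ρ * (κ₁ / invProfile Φ n ρ) := by
              gcongr
              exact h.invProfile_anti hlam hρ (min_le_left _ _)
          _ = κ * κ₁ * (invProfile Φ lam ρ / invProfile Φ n ρ) := by ring
          _ ≤ κ * κ₁ * (C₁ * (invProfile Φ lam t / invProfile Φ n t)) := by
              gcongr
              rw [div_le_iff₀ hwt] at hq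
              rw [div_le_iff₀ ha, ← mul_div_assoc, div_mul_eq_mul_div, le_div_iff₀ hat]
              calc _ ≤ invProfile Φ lam ρ * (C₁ * (invProfile Φ n ρ / invProfile Φ lam ρ) *
                    invProfile Φ lam t) := by gcongr
                _ = _ := by field_simp
          _ = _ := by ring

theorem exists_rpow_le_fracMaximal_indicator_ball (n : ℕ) (hn : 0 < n) (α : ℝ) :
    ∃ c : ℝ≥0, 0 < c ∧ ∀ (z : Rn n) (t : ℝ≥0), 0 < t → ∀ x ∈ Metric.ball z (t : ℝ),
      ((c * t ^ α : ℝ≥0) : ℝ≥0∞) ≤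
        fracMaximal α ((Metric.ball z (t : ℝ)).indicator fun _ => (1 : 𝕜)) x := by
  obtain ⟨ω, hω, hvol⟩ := exists_volume_ball n
  refine ⟨(2 ^ n) ^ (-1 + α / n) * ω ^ (α / n),
    mul_pos (NNReal.rpow_pos (by positivity)) (NNReal.rpow_pos hω), fun z t ht x hx => ?_⟩
  have ht2 : (0 : ℝ) < ((2 * t : ℝ≥0) : ℝ) := by positivity
  -- Radius `2t` about `x` swallows the whole ball `B(z, t)`.
  refine le_iSup_of_le ((2 * t : ℝ≥0) : ℝ) (le_iSup_of_le ht2 ?_)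
  have hsub : Metric.ball z (t : ℝ) ⊆ Metric.ball x ((2 * t : ℝ≥0) : ℝ) := by
    apply Metric.ball_subset_ball'
    rw [Metric.mem_ball, dist_comm] at hx
    push_cast
    linarith
  have hint : ∫⁻ y in Metric.ball x ((2 * t : ℝ≥0) : ℝ),
      ‖(Metric.ball z (t : ℝ)).indicator (fun _ => (1 : 𝕜)) y‖ₑ = volume (Metric.ball z (t : ℝ)) := by
    have h1 : ∀ y, ‖(Metric.ball z (t : ℝ)).indicator (fun _ => (1 : 𝕜)) y‖ₑ =
        (Metric.ball z (t : ℝ)).indicator (fun _ => (1 : ℝ≥0∞)) y := by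
      intro y
      by_cases hy : y ∈ Metric.ball z (t : ℝ) <;> simp [hy]
    simp_rw [h1]
    rw [lintegral_indicator_const measurableSet_ball, one_mul,
      Measure.restrict_apply measurableSet_ball, inter_eq_left.2 hsub]
  rw [hint, hvol z t ht, hvol x (2 * t) (by positivity),
    ← ENNReal.coe_rpow_of_ne_zero (by positivity), ← ENNReal.coe_mul, ENNReal.coe_le_coe]
  apply le_of_eq
  have hV : ω * t ^ n ≠ 0 := by positivity
  have h2 : ω * (2 * t) ^ n = 2 ^ n * (ω * t ^ n) := by ring
  rw [h2, NNReal.mul_rpow, NNReal.rpow_add hV, NNReal.rpow_neg_one, NNReal.mul_rpow (x := ω),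
    ← NNReal.rpow_natCast t n, ← NNReal.rpow_mul, mul_div_cancel₀ _ (by positivity : (n : ℝ) ≠ 0),
    NNReal.rpow_natCast]
  field_simp

/-- Testing the weak norm at the single level `s`, where the level set contains the whole ball,
gives `Φ((s/l)^{1/β}) |B| ≤ 1`, hence `(s/l)^{1/β} ≲ a(t)`. -/
theorem IsYoung.exists_le_weakOrliczNorm (h : IsYoung Φ) (hn : 0 < n) {β : ℝ} (hβ : 0 < β)
    (hΨ : ∀ t : ℝ≥0, Ψ t = Φ (t ^ (1 / β))) :
    ∃ κ : ℝ≥0, 0 < κ ∧ ∀ (z : Rn n) (t s : ℝ≥0), 0 < t → 0 < s → ∀ g : Rn n → ℝ≥0∞,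
      (∀ x ∈ Metric.ball z (t : ℝ), s < g x) → (s : ℝ≥0∞) ≤
        (κ * invProfile Φ n t ^ β : ℝ≥0) * weakOrliczNorm Ψ ((Metric.ball z t).indicator g) := by
  obtain ⟨κ, hκ, H⟩ := h.exists_map_mul_volume hn
  have hκ0 : 0 < κ := one_pos.trans_le hκ
  refine ⟨κ ^ β, NNReal.rpow_pos hκ0, fun z t s ht hs g hg => ?_⟩
  have ha := h.invProfile_pos n ht
  have hκa : 0 < (κ * invProfile Φ n t) ^ β := NNReal.rpow_pos (by positivity)
  rw [← NNReal.mul_rpow, mul_comm, ← ENNReal.div_le_iff (by simpa using hκa.ne') (by simp)]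
  refine le_iInf₂ fun l hl => le_iInf fun hle => ?_
  rw [ENNReal.div_le_iff (by simpa using hκa.ne') (by simp), ← ENNReal.coe_mul, ENNReal.coe_le_coe]
  have h1 : Ψ (s / l) * distrib ((Metric.ball z t).indicator g) s ≤ 1 :=
    (le_iSup₂ (f := fun (t' : ℝ≥0) (_ : 0 < t') =>
      Ψ (t' / l) * distrib ((Metric.ball z t).indicator g) t') s hs).trans hle
  have h2 : Φ ((s / l) ^ (1 / β)) * volume (Metric.ball z (t : ℝ)) ≤ 1 := by
    rw [← hΨ]
    refine le_trans (mul_le_mul_right (measure_mono fun x hx => ?_) _) h1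
    simpa only [mem_ofPred_eq, indicator_of_mem hx] using hg x hx
  have h3 := NNReal.rpow_le_rpow ((H z t ht _).2 h2) hβ.le
  rw [← NNReal.rpow_mul, one_div_mul_cancel hβ.ne', NNReal.rpow_one, div_le_iff₀ hl] at h3
  rwa [mul_comm]

theorem IsYoung.rpow_le_of_fracMaximalBounded (h : IsYoung Φ) (hn : 0 < n)
    {α lam β : ℝ} (hlam : 0 ≤ lam) (hβ : 0 < β)
    (hΨ : ∀ t : ℝ≥0, Ψ t = Φ (t ^ (1 / β))) {C₁ : ℝ≥0}
    (hQ : ∀ r ρ : ℝ≥0, 0 < r → r ≤ ρ → invProfile Φ n ρ / invProfile Φ lam ρ ≤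
      C₁ * (invProfile Φ n r / invProfile Φ lam r))
    (hM : FracMaximalBounded 𝕜 n α lam Φ Ψ) :
    ∃ C : ℝ≥0, ∀ t : ℝ≥0, 0 < t →
      t ^ α ≤ C * (invProfile Φ n t / invProfile Φ lam t) ^ (β - 1) := by
  obtain ⟨C, hC⟩ := hM
  obtain ⟨D, hD⟩ := h.exists_orliczMorreyNorm_indicator_ball_le (𝕜 := 𝕜) hn hlam hQ
  obtain ⟨c, hc, hcα⟩ := exists_rpow_le_fracMaximal_indicator_ball (𝕜 := 𝕜) n hn α
  obtain ⟨κ, hκ, Hκ⟩ := h.exists_le_weakOrliczNorm hn hβ hΨ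
  obtain ⟨κ₁, hκ₁, Hκ₁⟩ := h.exists_youngInv_volume hn lam
  have hκ₁0 : 0 < κ₁ := one_pos.trans_le hκ₁
  refine ⟨2 * κ₁ ^ β * κ * C * D / c, fun t ht => ?_⟩
  set z : Rn n := 0
  set f := (Metric.ball z (t : ℝ)).indicator fun _ => (1 : 𝕜) with hf
  have hfmem : MemOrliczMorrey Φ lam f :=
    ⟨h.memOrliczLoc_indicator_ball z t, (hD z t ht).trans_lt ENNReal.coe_lt_top⟩
  have ha := h.invProfile_pos n ht
  have hw := h.invProfile_pos lam ht
  have htα : 0 < t ^ α := NNReal.rpow_pos ht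
  -- Half of the lower bound for `M_α f`, so that the level is exceeded strictly.
  have hs : 0 < c * t ^ α / 2 := by positivity
  set W := weakOrliczNorm Ψ ((Metric.ball z (t : ℝ)).indicator (fracMaximal α f))
  have h1 : ((c * t ^ α / 2 : ℝ≥0) : ℝ≥0∞) ≤ (κ * invProfile Φ n t ^ β : ℝ≥0) * W := by
    refine Hκ z t _ ht hs _ fun x hx => lt_of_lt_of_le ?_ (hcα z t ht x hx)
    rw [ENNReal.coe_lt_coe]
    exact NNReal.half_lt_self (by positivity)
  have h2 : youngInv Ψ (volume (Metric.ball z (t : ℝ)) ^ (-lam / n)) * W ≤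
      (C * (D * (invProfile Φ lam t / invProfile Φ n t)) : ℝ≥0) := by
    refine (le_weakOrliczMorreyNorm _ z (NNReal.coe_pos.2 ht)).trans
      ((hC f hfmem).2.trans ?_)
    rw [ENNReal.coe_mul]
    gcongr
    exact hD z t ht
  rw [youngInv_rpow hβ hΨ] at h2
  have h3 : ((invProfile Φ lam t ^ β : ℝ≥0) : ℝ≥0∞) * W ≤
      (κ₁ ^ β * (C * (D * (invProfile Φ lam t / invProfile Φ n t))) : ℝ≥0) := by
    calc _ ≤ (κ₁ * youngInv Φ (volume (Metric.ball z (t : ℝ)) ^ (-lam / n))) ^ β * W := by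
          rw [ENNReal.coe_rpow_of_nonneg _ hβ.le]
          gcongr
          exact (Hκ₁ z t ht).2
      _ = (κ₁ ^ β : ℝ≥0) *
            (youngInv Φ (volume (Metric.ball z (t : ℝ)) ^ (-lam / n)) ^ β * W) := by
          rw [ENNReal.mul_rpow_of_nonneg _ _ hβ.le, ENNReal.coe_rpow_of_nonneg _ hβ.le, mul_assoc]
      _ ≤ _ := by
          rw [ENNReal.coe_mul]
          gcongr
  -- Eliminating `W` between its lower bound `h1` and its upper bound `h3` leaves an inequality
  -- among positive reals.
  have h4 : invProfile Φ lam t ^ β * (c * t ^ α / 2) ≤ κ * invProfile Φ n t ^ β *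
      (κ₁ ^ β * (C * (D * (invProfile Φ lam t / invProfile Φ n t)))) := by
    rw [← ENNReal.coe_le_coe, ENNReal.coe_mul]
    calc _ ≤ ((invProfile Φ lam t ^ β : ℝ≥0) : ℝ≥0∞) *
          ((κ * invProfile Φ n t ^ β : ℝ≥0) * W) := by gcongr
      _ = (κ * invProfile Φ n t ^ β : ℝ≥0) * ((invProfile Φ lam t ^ β : ℝ≥0) * W) := by ring
      _ ≤ _ := by
          rw [ENNReal.coe_mul (κ * invProfile Φ n t ^ β)]
          gcongr
  have hwβ : 0 < invProfile Φ lam t ^ β := NNReal.rpow_pos hw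
  have haβ : 0 < invProfile Φ n t ^ β := NNReal.rpow_pos ha
  have hq : (invProfile Φ n t / invProfile Φ lam t) ^ (β - 1) =
      invProfile Φ n t ^ β / invProfile Φ lam t ^ β *
        (invProfile Φ lam t / invProfile Φ n t) := by
    rw [NNReal.rpow_sub (div_pos ha hw).ne', NNReal.rpow_one, NNReal.div_rpow]
    field_simp
  rw [hq]
  generalize invProfile Φ lam t ^ β = wβ at *
  generalize invProfile Φ n t ^ β = aβ at *
  calc t ^ α = wβ * (c * t ^ α / 2) * (2 / (c * wβ)) := by field_simp
    _ ≤ κ * aβ * (κ₁ ^ β * (C * (D * (invProfile Φ lam t / invProfile Φ n t)))) *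
          (2 / (c * wβ)) := by gcongr
    _ = _ := by field_simp

end Necessity

end OrliczMorrey

/-! ### The equivalence -/

theorem mainTheorem6 {𝕜 : Type*} [RCLike 𝕜] (n : ℕ) (α lam β : ℝ)
    (hα : 0 < α) (hαn : α < n) (hlam : 0 ≤ lam) (hlamn : lam ≤ n) (hβ : 0 < β) (hβ1 : β < 1)
    (Φ Ψ : ℝ≥0 → ℝ≥0∞) (hΦ : OrliczMorrey.DeltaPrime Φ)
    (hΨ : ∀ t : ℝ≥0, Ψ t = Φ (t ^ (1 / β)))
    (hreg : ∃ C : ℝ≥0, 0 < C ∧ ∀ t : ℝ≥0, 0 < t →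
      (⨆ (r : ℝ≥0) (_ : t < r), (r : ℝ≥0∞) ^ α * OrliczMorrey.invQuotient n lam Φ r) ≤
        C * ((t : ℝ≥0∞) ^ α * OrliczMorrey.invQuotient n lam Φ t)) :
    (∃ C : ℝ≥0, 0 < C ∧ ∀ t : ℝ≥0, 0 < t →
      (t : ℝ≥0∞) ^ α ≤ C * OrliczMorrey.invQuotient n lam Φ t ^ (β - 1)) ↔
    OrliczMorrey.FracMaximalBounded 𝕜 n α lam Φ Ψ := by
  have h : OrliczMorrey.IsYoung Φ := hΦ.1
  have hn : 0 < n := by exact_mod_cast hα.trans hαn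
  have hq : ∀ r : ℝ≥0, 0 < r →
      0 < OrliczMorrey.invProfile Φ n r / OrliczMorrey.invProfile Φ lam r := fun r hr =>
    div_pos (h.invProfile_pos _ hr) (h.invProfile_pos _ hr)
  obtain ⟨C₁, hC₁, hreg⟩ := hreg
  have hQ : ∀ r ρ : ℝ≥0, 0 < r → r ≤ ρ →
      OrliczMorrey.invProfile Φ n ρ / OrliczMorrey.invProfile Φ lam ρ ≤
        -- The supremum in the hypothesis runs over radii strictly larger than `t`; the 1 covers the
        -- case `ρ = r`.
        max 1 C₁ * (OrliczMorrey.invProfile Φ n r / OrliczMorrey.invProfile Φ lam r) := by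
    intro r ρ hr hrρ
    rcases hrρ.eq_or_lt with rfl | hlt
    · exact le_mul_of_one_le_left (zero_le) (le_max_left _ _)
    have hρ := hr.trans hlt
    have h1 := (le_iSup₂ (f := fun (ρ : ℝ≥0) (_ : r < ρ) =>
      (ρ : ℝ≥0∞) ^ α * OrliczMorrey.invQuotient n lam Φ ρ) ρ hlt).trans (hreg r hr)
    rw [h.coe_invQuotient n lam hr, h.coe_invQuotient n lam hρ, ← ENNReal.coe_rpow_of_nonneg _ hα.le,
      ← ENNReal.coe_rpow_of_nonneg _ hα.le, ← ENNReal.coe_mul, ← ENNReal.coe_mul, ← ENNReal.coe_mul,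
      ENNReal.coe_le_coe] at h1
    have hrα : 0 < r ^ α := NNReal.rpow_pos hr
    refine le_of_mul_le_mul_left ?_ hrα
    -- `r^α ≤ ρ^α` lets the power be dropped, leaving `q` itself almost decreasing.
    calc _ ≤ ρ ^ α * (OrliczMorrey.invProfile Φ n ρ / OrliczMorrey.invProfile Φ lam ρ) := by gcongr
      _ ≤ _ := h1
      _ = r ^ α *
          (C₁ * (OrliczMorrey.invProfile Φ n r / OrliczMorrey.invProfile Φ lam r)) := by ring
      _ ≤ _ := by
        gcongr
        exact le_max_right _ _
  have hcond : ∀ (C t : ℝ≥0), 0 < t →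
      ((t : ℝ≥0∞) ^ α ≤ C * OrliczMorrey.invQuotient n lam Φ t ^ (β - 1) ↔ t ^ α ≤
        C * (OrliczMorrey.invProfile Φ n t / OrliczMorrey.invProfile Φ lam t) ^ (β - 1)) := by
    intro C t ht
    rw [h.coe_invQuotient n lam ht, ← ENNReal.coe_rpow_of_nonneg _ hα.le,
      ← ENNReal.coe_rpow_of_ne_zero (hq t ht).ne', ← ENNReal.coe_mul, ENNReal.coe_le_coe]
  constructor
  · rintro ⟨C, hC, H⟩
    exact h.fracMaximalBounded_of_rpow_le hn hlam hβ hβ1 hΨ hC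
      (fun t ht => (hcond C t ht).1 (H t ht)) hQ
  · intro hM
    obtain ⟨C, hC⟩ := h.rpow_le_of_fracMaximalBounded hn hlam hβ hΨ hQ hM
    -- The constant obtained may be zero, whereas a positive one is demanded.
    refine ⟨C + 1, by positivity, fun t ht => (hcond _ t ht).2 ((hC t ht).trans ?_)⟩
    gcongr
    exact le_self_add
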